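/- Let $\Lambda=(\lambda_n)_{n\ge 0}$ be a lacunary sequence, i.e. a sequence of positive real numbers such that, for some $r>1$, $\lambda_{n+1}\ge r\lambda_n$ for all $n$. For $q\in[1,\infty)$ let $M_\Lambda^q$ be the closed linear span of the monomials $t^{\lambda_n}$, $n\in\mathbb N$, in the complex space $L^q([0,1],m)$, $m$ the Lebesgue measure. Let $\mu$ be a finite positive Borel measure on $[0,1)$ and suppose that for some $p\in[1,\infty)$ $$\lim_{n\to\infty}\lambda_n\int_{[0,1)}t^{p\lambda_n}\,d\mu(t)=0 .\qquad (b_p)$$ Then for every real $q>p$ the Carleson embedding $$i_\mu^q:M_\Lambda^q\to L^q(\mu),\qquad f\mapsto f,$$ is a well-defined compact linear operator. Here the function $f\in M_\Lambda^q$ is evaluated at the points of $[0,1)$ through its (unique) representative of the form $f(t)=\sum_n a_nt^{\lambda_n}$, the series converging at every $t\in[0,1)$. -/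

import Mathlib

open MeasureTheory Filter Topology Set

noncomputable section

namespace Muntz

/-- A sequence of positive reals is lacunary if `u (n+1) ≥ r * u n` for all `n`, for some `r > 1`. -/
def IsLacunary (u : ℕ → ℝ) : Prop :=
  (∀ n, 0 < u n) ∧ ∃ r : ℝ, 1 < r ∧ ∀ n, r * u n ≤ u (n + 1)

/-- The Lebesgue measure `m` on `[0,1]`. -/
abbrev lebesgueI : Measure ℝ := volume.restrict (Icc (0 : ℝ) 1)

/-- The space `L^q(μ)` of complex-valued functions, for a real exponent `q`. -/
abbrev LpC (q : ℝ) (μ : Measure ℝ) := Lp ℂ (ENNReal.ofReal q) μ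

/-- The monomial `t ↦ t ^ a` (only its values on `[0,1]` matter). -/
def monomial (a : ℝ) : ℝ → ℂ := fun t => ((t ^ a : ℝ) : ℂ)

/-- The Müntz space `M_Λ^q`: the closed linear span in `L^q(m)` of the monomials `t ^ (Λ n)`. -/
def muntzSpace (Λ : ℕ → ℝ) (q : ℝ) [Fact (1 ≤ ENNReal.ofReal q)] :
    Submodule ℂ (LpC q lebesgueI) :=
  (Submodule.span ℂ
    {f : LpC q lebesgueI | ∃ n : ℕ, (f : ℝ → ℂ) =ᵐ[lebesgueI] monomial (Λ n)}).topologicalClosure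

/-- `g t = ∑ aₙ t ^ (Λ n)` at every point `t` of `[0,1)`, for some complex coefficients `aₙ`. -/
def HasMuntzExpansion (Λ : ℕ → ℝ) (g : ℝ → ℂ) : Prop :=
  ∃ a : ℕ → ℂ, ∀ t ∈ Ico (0 : ℝ) 1, HasSum (fun n => a n * monomial (Λ n) t) (g t)

/-- `i` is the Carleson embedding `f ↦ f` from `M_Λ^q` to `L^q(μ)`. An element of `M_Λ^q` is a class
of functions modulo Lebesgue-null sets; the function meant on `[0,1)` is its representative that is
given at every point of `[0,1)` by a Müntz series, and `i f` is the class of that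
function modulo `μ`-null sets. -/
def IsCarlesonEmbedding (Λ : ℕ → ℝ) (q : ℝ) [Fact (1 ≤ ENNReal.ofReal q)] (μ : Measure ℝ)
    (i : muntzSpace Λ q →L[ℂ] LpC q μ) : Prop :=
  ∀ f : muntzSpace Λ q, ∃ g : ℝ → ℂ, HasMuntzExpansion Λ g ∧
    ((f : LpC q lebesgueI) : ℝ → ℂ) =ᵐ[lebesgueI] g ∧ (i f : ℝ → ℂ) =ᵐ[μ] g

/-- Condition `(b_p)`: `Λ n * ∫_{[0,1)} t ^ (p * Λ n) dμ → 0`. -/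
def ConditionSmallB (Λ : ℕ → ℝ) (p : ℝ) (μ : Measure ℝ) : Prop :=
  Tendsto (fun n => Λ n * ∫ t in Ico (0 : ℝ) 1, t ^ (p * Λ n) ∂μ) atTop (𝓝 0)

end Muntz

end

open scoped NNReal ENNReal

namespace Muntz

/-! Everything is transported to `ℓ^q`. Put `w n = Λ n + 1/q` and normalise the monomials to `w n ^
(1/q) * t ^ Λ n`. For `ν` equal to `m` or `μ`, the synthesis operator sends `b` to `∑ b n * w n ^
(1/q) * t ^ Λ n` in `L^q(ν)`. If synthesis into `L^q(m)` has a bounded left inverse `B`, then `B`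
reads off the coefficients of each `f` in `M_Λ^q`, and the Carleson embedding is synthesis into
`L^q(μ)` after `B`. It then suffices that synthesis into `L^q(μ)` is compact.

Upper bounds: a Hölder splitting of the series, with the weights balanced by lacunarity, gives a
pointwise Schur estimate (`exists_rpow_lacunary_series_le`): the `q`-th power of the sum is at most
a double sum of `|b n| ^ q` against `ρ ^ |n - k|` times the test functions `w n * t ^ (p * Λ n)`.
The strict inequality `p < q` leaves a spare power of `t ^ Λ n`, which supplies the decay.
Integrated, this bounds synthesis by the supremum `D` of the test integrals, with a constant
depending only on `r, p, q`. For `m` the test exponent 1 works; for `μ` it is `(b_p)`. Tails of the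
sequence have the same ratio, and their `D` tends to 0 by `(b_p)`, so synthesis into `L^q(μ)` is a
norm limit of finite-rank operators.

Left inverse: with `s = log (1/t)`, monomials become exponentials. Pairing with dilates of a kernel
whose Laplace transform is `(4z/(1+z)^2)^(M+2)`, which equals 1 at `z = 1` and is smaller elsewhere,
defines a bounded analysis operator `A` from `L^q(m)` to `ℓ^q`. The matrix of `A` after synthesis
has unit diagonal, and its off-diagonal part is as small as desired for large `M`. A Schur test and
a Neumann series make it invertible. -/

/-! ### Lacunary sequences and powers of lacunary sums -/

/-- `w` is a positive sequence whose consecutive ratios are at least `r`. -/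
def LacunaryWith (r : ℝ) (w : ℕ → ℝ) : Prop :=
  (∀ n, 0 < w n) ∧ ∀ n, r * w n ≤ w (n + 1)

theorem LacunaryWith.shift {r : ℝ} {w : ℕ → ℝ} (h : LacunaryWith r w) (N : ℕ) :
    LacunaryWith r (fun n => w (n + N)) :=
  ⟨fun n => h.1 _, fun n => by
    have := h.2 (n + N)
    rwa [show n + N + 1 = n + 1 + N by ring] at this⟩

theorem LacunaryWith.le_pow_mul {r : ℝ} (hr : 1 < r) {w : ℕ → ℝ} (h : LacunaryWith r w) (n m : ℕ) :
    w n ≤ r⁻¹ ^ m * w (n + m) := by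
  have hr0 : 0 < r := by linarith
  induction m with
  | zero => simp
  | succ m ih =>
    refine ih.trans ?_
    have h1 : w (n + m) ≤ r⁻¹ * w (n + (m + 1)) := by
      rw [inv_mul_eq_div, le_div_iff₀ hr0, mul_comm]
      exact h.2 (n + m)
    calc r⁻¹ ^ m * w (n + m) ≤ r⁻¹ ^ m * (r⁻¹ * w (n + (m + 1))) := by gcongr
      _ = _ := by ring

theorem LacunaryWith.div_le {r : ℝ} (hr : 1 < r) {w : ℕ → ℝ} (h : LacunaryWith r w) {n k : ℕ}
    (hnk : n ≤ k) : w n / w k ≤ r⁻¹ ^ (k - n) := by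
  rw [div_le_iff₀ (h.1 k)]
  have := h.le_pow_mul hr n (k - n)
  rwa [Nat.add_sub_cancel' hnk] at this

/-- The powers grow at least geometrically, so a partial sum is comparable to its last term; the
constant is the sum of the geometric series of ratio `r⁻¹ ^ δ`. -/
theorem LacunaryWith.sum_rpow_le {r : ℝ} (hr : 1 < r) {δ : ℝ} (hδ : 0 < δ) {w : ℕ → ℝ}
    (h : LacunaryWith r w) (k : ℕ) :
    ∑ j ∈ Finset.range (k + 1), w j ^ δ ≤ (1 - (r⁻¹) ^ δ)⁻¹ * w k ^ δ := by
  have hr0 : 0 < r := by linarith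
  have hx : (r⁻¹) ^ δ < 1 := Real.rpow_lt_one (by positivity) (inv_lt_one_of_one_lt₀ hr) hδ
  have hx0 : 0 < (r⁻¹) ^ δ := by positivity
  have h1 : 0 < 1 - (r⁻¹) ^ δ := by linarith
  induction k with
  | zero =>
    simp only [zero_add, Finset.range_one, Finset.sum_singleton]
    have := Real.rpow_pos_of_pos (h.1 0) δ
    exact le_mul_of_one_le_left this.le (one_le_inv_iff₀.2 ⟨h1, by linarith⟩)
  | succ k ih =>
    rw [Finset.sum_range_succ]
    have h2 : w k ^ δ ≤ (r⁻¹) ^ δ * w (k + 1) ^ δ := by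
      rw [← Real.mul_rpow (by positivity) (h.1 _).le]
      have := h.le_pow_mul hr k 1
      rw [pow_one] at this
      exact Real.rpow_le_rpow (h.1 k).le this hδ.le
    calc _ ≤ (1 - (r⁻¹) ^ δ)⁻¹ * ((r⁻¹) ^ δ * w (k + 1) ^ δ) + w (k + 1) ^ δ := by
          gcongr
          exact ih.trans (by gcongr)
      _ = (1 - (r⁻¹) ^ δ)⁻¹ * w (k + 1) ^ δ * ((r⁻¹) ^ δ + (1 - (r⁻¹) ^ δ)) := by
          have h3 := h1.ne'
          generalize (r⁻¹) ^ δ = x at h3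
          field_simp
      _ = _ := by ring

theorem rpow_sum_le_sum_rpow {m : ℝ} (hm : 0 < m) (hm1 : m ≤ 1) (v : ℕ → ℝ) (hv : ∀ n, 0 ≤ v n)
    (N : ℕ) : (∑ k ∈ Finset.range N, v k) ^ m ≤ ∑ k ∈ Finset.range N, v k ^ m := by
  induction N with
  | zero => simp [Real.zero_rpow hm.ne']
  | succ N ih =>
    rw [Finset.sum_range_succ, Finset.sum_range_succ]
    exact (Real.rpow_add_le_add_rpow (Finset.sum_nonneg fun i _ => hv i) (hv N) hm.le hm1).trans
      (by gcongr)

/-- Bernoulli's inequality at `-x / (a + x)`: the tangent to `s ^ m` at `a + x` lies below the graph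
at `a`. -/
theorem rpow_add_sub_rpow_le {m : ℝ} (hm : 1 ≤ m) {a x : ℝ} (ha : 0 ≤ a) (hx : 0 ≤ x) :
    (a + x) ^ m ≤ a ^ m + m * x * (a + x) ^ (m - 1) := by
  rcases hx.eq_or_lt with rfl | hx
  · simp
  have hs : 0 < a + x := by linarith
  have h1 : -1 ≤ -(x / (a + x)) := by
    rw [neg_le_neg_iff, div_le_one hs]; linarith
  have h2 := one_add_mul_self_le_rpow_one_add h1 hm
  have h3 : 1 + -(x / (a + x)) = a / (a + x) := by field_simp; ring
  rw [h3, Real.div_rpow ha hs.le, le_div_iff₀ (by positivity)] at h2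
  have h4 : (a + x) ^ m = (a + x) ^ (m - 1) * (a + x) := by
    rw [← Real.rpow_add_one hs.ne']; ring_nf
  have h5 : x / (a + x) * (a + x) ^ m = x * (a + x) ^ (m - 1) := by
    rw [h4]; field_simp
  nlinarith [h2, h5]

/-- The `m`-th power of the sum telescopes over its partial sums, and each increment is bounded by
the tangent estimate. -/
theorem rpow_sum_le_sum_mul_rpow {m : ℝ} (hm : 1 ≤ m) (v : ℕ → ℝ) (hv : ∀ n, 0 ≤ v n) (N : ℕ) :
    (∑ k ∈ Finset.range N, v k) ^ m ≤
      m * ∑ k ∈ Finset.range N, v k * (∑ j ∈ Finset.range (k + 1), v j) ^ (m - 1) := by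
  induction N with
  | zero => simp [Real.zero_rpow (by linarith : m ≠ 0)]
  | succ N ih =>
    rw [Finset.sum_range_succ _ N, Finset.sum_range_succ _ N, mul_add]
    have := rpow_add_sub_rpow_le hm (Finset.sum_nonneg (s := Finset.range N) fun i _ => hv i) (hv N)
    rw [Finset.sum_range_succ v N]
    linarith

/-- A lacunary sum raised to a power is controlled by the sum of the powers. -/
theorem exists_rpow_lacunary_sum_le {r : ℝ} (hr : 1 < r) {δ m : ℝ} (hδ : 0 < δ) (hm : 0 < m) :
    ∃ C : ℝ, 0 ≤ C ∧ ∀ w : ℕ → ℝ, LacunaryWith r w → ∀ τ : ℕ → ℝ, (∀ n, τ n ∈ Icc (0 : ℝ) 1) →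
      ∀ N, (∑ k ∈ Finset.range N, w k ^ δ * τ k) ^ m ≤
        C * ∑ k ∈ Finset.range N, w k ^ (δ * m) * τ k ^ (min m 1) := by
  have hr0 : 0 < r := by linarith
  have hx : (r⁻¹) ^ δ < 1 := Real.rpow_lt_one (by positivity) (inv_lt_one_of_one_lt₀ hr) hδ
  have h1 : 0 < 1 - (r⁻¹) ^ δ := by linarith
  rcases le_total m 1 with hm1 | hm1
  · refine ⟨1, zero_le_one, fun w hw τ hτ N => ?_⟩
    rw [one_mul, min_eq_left hm1]
    refine (rpow_sum_le_sum_rpow hm hm1 _ (fun n => mul_nonneg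
      (Real.rpow_nonneg (hw.1 n).le _) (hτ n).1) N).trans (le_of_eq ?_)
    refine Finset.sum_congr rfl fun k _ => ?_
    rw [Real.mul_rpow (Real.rpow_nonneg (hw.1 k).le _) (hτ k).1, Real.rpow_mul (hw.1 k).le]
  -- Inside each partial sum the `τ j` are bounded by 1 and the geometric bound applies; only one
  -- factor `τ k` survives, whence the exponent `min m 1`.
  · refine ⟨m * ((1 - (r⁻¹) ^ δ)⁻¹) ^ (m - 1), by positivity, fun w hw τ hτ N => ?_⟩
    have hw0 := fun n => (hw.1 n).le
    rw [min_eq_right hm1]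
    refine (rpow_sum_le_sum_mul_rpow hm1 _ (fun n => mul_nonneg
      (Real.rpow_nonneg (hw0 n) _) (hτ n).1) N).trans ?_
    rw [mul_assoc, Finset.mul_sum _ _ (((1 - (r⁻¹) ^ δ)⁻¹) ^ (m - 1))]
    refine mul_le_mul_of_nonneg_left (Finset.sum_le_sum fun k _ => ?_) (by linarith)
    have h2 : ∑ j ∈ Finset.range (k + 1), w j ^ δ * τ j ≤ (1 - (r⁻¹) ^ δ)⁻¹ * w k ^ δ := by
      refine le_trans (Finset.sum_le_sum fun j _ => ?_) (hw.sum_rpow_le hr hδ k)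
      exact mul_le_of_le_one_right (Real.rpow_nonneg (hw0 j) _) (hτ j).2
    have h3 : 0 ≤ ∑ j ∈ Finset.range (k + 1), w j ^ δ * τ j :=
      Finset.sum_nonneg fun j _ => mul_nonneg (Real.rpow_nonneg (hw0 j) _) (hτ j).1
    have hk := hw.1 k
    have hτk := (hτ k).1
    calc w k ^ δ * τ k * (∑ j ∈ Finset.range (k + 1), w j ^ δ * τ j) ^ (m - 1)
        ≤ w k ^ δ * τ k * ((1 - (r⁻¹) ^ δ)⁻¹ * w k ^ δ) ^ (m - 1) := by
          exact mul_le_mul_of_nonneg_left (Real.rpow_le_rpow h3 h2 (by linarith)) (by positivity)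
      _ = ((1 - (r⁻¹) ^ δ)⁻¹) ^ (m - 1) * (w k ^ (δ * m) * τ k ^ (1 : ℝ)) := by
          rw [Real.mul_rpow (by positivity) (by positivity), Real.rpow_one, ← Real.rpow_mul hk.le,
            show δ * m = δ + δ * (m - 1) by ring, Real.rpow_add hk]
          ring

/-! ### Pointwise Schur estimate for lacunary series -/

theorem rpow_sum_mul_le {q : ℝ} (hq : 1 < q) (s : Finset ℕ) (y v : ℕ → ℝ) (hy : ∀ n, 0 ≤ y n)
    (hv : ∀ n, 0 ≤ v n) :
    (∑ n ∈ s, y n * v n) ^ q ≤ (∑ n ∈ s, y n ^ q) * (∑ n ∈ s, v n ^ (q / (q - 1))) ^ (q - 1) := by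
  have hc : q.HolderConjugate (q / (q - 1)) := Real.HolderConjugate.conjExponent hq
  have h := Real.inner_le_Lp_mul_Lq_of_nonneg s hc (fun i _ => hy i) (fun i _ => hv i)
  have hq1 : 0 < q - 1 := by linarith
  have hA : 0 ≤ ∑ n ∈ s, y n ^ q := Finset.sum_nonneg fun i _ => Real.rpow_nonneg (hy i) _
  have hB : 0 ≤ ∑ n ∈ s, v n ^ (q / (q - 1)) :=
    Finset.sum_nonneg fun i _ => Real.rpow_nonneg (hv i) _
  refine (Real.rpow_le_rpow (Finset.sum_nonneg fun i _ => mul_nonneg (hy i) (hv i)) h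
    (by linarith)).trans (le_of_eq ?_)
  rw [Real.mul_rpow (by positivity) (by positivity), ← Real.rpow_mul hA, ← Real.rpow_mul hB]
  congr 2
  · rw [one_div_mul_cancel (by linarith), Real.rpow_one]
  · field_simp

/-- The unequal split `1 - σ`, `σ` of the weights produces the decay. For `k ≤ n` the factor `(w k /
w n) ^ σ` appears directly; for `n ≤ k` the extra power of `τ k` compensates the larger weight `w
k`. -/
theorem LacunaryWith.rpow_mul_rpow_le {r : ℝ} (hr : 1 < r) {w : ℕ → ℝ} (hw : LacunaryWith r w)
    {τ : ℕ → ℝ} (hτ : ∀ n, τ n ∈ Icc (0 : ℝ) 1) {p σ : ℝ} (hp : 1 ≤ p) (hσ : 0 < σ)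
    (hσ1 : 2 * σ ≤ 1) (n k : ℕ) :
    w n ^ (1 - σ) * w k ^ σ * (τ n ^ p * τ k ^ (p * (2 * σ))) ≤
      ((r⁻¹) ^ σ) ^ (n - k + (k - n)) * (w n * τ n ^ p + w k * τ k ^ p) := by
  have hr0 : 0 < r := by linarith
  have hn := hw.1 n
  have hk := hw.1 k
  have hτn := (hτ n).1
  have hτk := (hτ k).1
  have e (d : ℕ) : ((r⁻¹) ^ σ) ^ d = ((r⁻¹) ^ d) ^ σ := by
    rw [← Real.rpow_natCast, ← Real.rpow_natCast, ← Real.rpow_mul (by positivity),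
      ← Real.rpow_mul (by positivity), mul_comm]
  rcases le_total k n with h | h
  · rw [Nat.sub_eq_zero_of_le h, add_zero, e]
    have h1 : (w k / w n) ^ σ ≤ ((r⁻¹) ^ (n - k)) ^ σ :=
      Real.rpow_le_rpow (by positivity) (hw.div_le hr h) hσ.le
    calc _ ≤ w n ^ (1 - σ) * w k ^ σ * (τ n ^ p * 1) := by
          gcongr
          exact Real.rpow_le_one hτk (hτ k).2 (by positivity)
      _ = (w k / w n) ^ σ * (w n * τ n ^ p) := by
          rw [Real.div_rpow hk.le hn.le, Real.rpow_sub hn, Real.rpow_one]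
          ring
      _ ≤ _ := by
          gcongr
          exact le_add_of_nonneg_right (by positivity)
  · rw [Nat.sub_eq_zero_of_le h, zero_add, e]
    have h1 : (w n / w k) ^ σ ≤ ((r⁻¹) ^ (k - n)) ^ σ :=
      Real.rpow_le_rpow (by positivity) (hw.div_le hr h) hσ.le
    -- With the weights `1 - 2σ` and `2σ`, the geometric mean contains `w n ^ (1 - 2σ) * w k ^
    -- (2σ)`, which is the given weight product divided by `(w n / w k) ^ σ`.
    have h2 := Real.geom_mean_le_arith_mean2_weighted (w₁ := 1 - 2 * σ) (w₂ := 2 * σ)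
      (p₁ := w n * τ n ^ p) (p₂ := w k * τ k ^ p) (by linarith) (by linarith) (by positivity)
      (by positivity) (by ring)
    have h3 : (1 - 2 * σ) * (w n * τ n ^ p) + 2 * σ * (w k * τ k ^ p) ≤
        w n * τ n ^ p + w k * τ k ^ p := by
      have ha : 0 ≤ w n * τ n ^ p := by positivity
      have hb : 0 ≤ w k * τ k ^ p := by positivity
      nlinarith
    have h4 : τ n ^ p ≤ (τ n ^ p) ^ (1 - 2 * σ) := by
      conv_lhs => rw [← Real.rpow_one (τ n ^ p)]
      rcases hτn.eq_or_lt with h0 | h0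
      · rw [← h0, Real.zero_rpow (by linarith)]
        rw [Real.rpow_one]
        positivity
      · exact Real.rpow_le_rpow_of_exponent_ge (by positivity)
          (Real.rpow_le_one hτn (hτ n).2 (by linarith)) (by linarith)
    calc _ ≤ w n ^ (1 - σ) * w k ^ σ * ((τ n ^ p) ^ (1 - 2 * σ) * τ k ^ (p * (2 * σ))) := by
          gcongr
      _ = (w n / w k) ^ σ * ((w n * τ n ^ p) ^ (1 - 2 * σ) * (w k * τ k ^ p) ^ (2 * σ)) := by
          rw [Real.div_rpow hn.le hk.le, Real.mul_rpow hn.le (by positivity),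
            Real.mul_rpow hk.le (by positivity), ← Real.rpow_mul hτk,
            show 1 - σ = σ + (1 - 2 * σ) by ring, Real.rpow_add hn, show 2 * σ = σ + σ by ring,
            Real.rpow_add hk]
          have : w k ^ σ ≠ 0 := (Real.rpow_pos_of_pos hk _).ne'
          field_simp
      _ ≤ _ := by
          gcongr
          exact h2.trans h3

/-- Pointwise Schur-type estimate for lacunary sums, with constants that depend only on the ratio
and on the exponents. -/
theorem exists_rpow_lacunary_series_le {r p q : ℝ} (hr : 1 < r) (hp : 1 ≤ p) (hpq : p < q) :
    ∃ C ρ : ℝ, 0 ≤ C ∧ 0 < ρ ∧ ρ < 1 ∧ ∀ w : ℕ → ℝ, LacunaryWith r w →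
      ∀ τ : ℕ → ℝ, (∀ n, τ n ∈ Icc (0 : ℝ) 1) → ∀ β : ℕ → ℝ, (∀ n, 0 ≤ β n) → ∀ N,
      (∑ n ∈ Finset.range N, β n * (w n ^ (1 / q) * τ n)) ^ q ≤
        C * ∑ n ∈ Finset.range N, ∑ k ∈ Finset.range N,
          β n ^ q * (ρ ^ (n - k + (k - n)) * (w n * τ n ^ p + w k * τ k ^ p)) := by
  have hr0 : 0 < r := by linarith
  have hq1 : 0 < q - 1 := by linarith
  have hq0 : 0 < q := by linarith
  have hp0 : 0 < p := by linarith
  set m := q - 1 with hm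
  set κ := (q - p) / m with hκ
  have hκ0 : 0 < κ := div_pos (by linarith) hq1
  have hmin : 0 < min m 1 := lt_min hq1 one_pos
  -- `κ` is the power of `τ` left over by Hölder, positive because `p < q`. The choice of `σ`
  -- ensures that `κ * min m 1` covers the exponent `2σp` needed by the kernel bound, and that `2σ ≤
  -- 1`.
  set σ := min (κ * min m 1 / p) 1 / 2 with hσ
  have hσ0 : 0 < σ := by
    rw [hσ]; exact half_pos (lt_min (by positivity) one_pos)
  have hσ1 : 2 * σ ≤ 1 := by
    rw [hσ]; linarith [min_le_right (κ * min m 1 / p) 1]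
  have hσ2 : p * (2 * σ) ≤ κ * min m 1 := by
    have := min_le_left (κ * min m 1 / p) 1
    rw [le_div_iff₀ hp0] at this
    rw [hσ]; linarith
  obtain ⟨C, hC, hS⟩ := exists_rpow_lacunary_sum_le hr (δ := σ / m) (m := m) (by positivity) hq1
  refine ⟨C, (r⁻¹) ^ σ, hC, by positivity,
    Real.rpow_lt_one (by positivity) (inv_lt_one_of_one_lt₀ hr) hσ0, ?_⟩
  intro w hw τ hτ β hβ N
  have hw0 := fun n => (hw.1 n).le
  -- The first factor has `q`-th power `β ^ q * w ^ (1 - σ) * τ ^ p`; the second, raised to the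
  -- conjugate exponent, is `w ^ (σ / m) * τ ^ κ`.
  have hsplit : ∀ n, β n * (w n ^ (1 / q) * τ n) =
      (β n * (w n ^ ((1 - σ) / q) * τ n ^ (p / q))) * (w n ^ (σ / q) * τ n ^ (1 - p / q)) := by
    intro n
    have h1 : w n ^ (1 / q) = w n ^ ((1 - σ) / q) * w n ^ (σ / q) := by
      rw [← Real.rpow_add (hw.1 n)]; congr 1; ring
    have h2 : τ n = τ n ^ (p / q) * τ n ^ (1 - p / q) := by
      rw [← Real.rpow_add_of_nonneg (hτ n).1 (by positivity)
        (by rw [sub_nonneg, div_le_one hq0]; exact hpq.le)]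
      simp
    rw [h1]
    nth_rewrite 1 [h2]
    ring
  have hA : ∀ n, (β n * (w n ^ ((1 - σ) / q) * τ n ^ (p / q))) ^ q =
      β n ^ q * (w n ^ (1 - σ) * τ n ^ p) := by
    intro n
    have := hw0 n
    have := (hτ n).1
    have := hβ n
    rw [Real.mul_rpow (by positivity) (by positivity), Real.mul_rpow (by positivity)
      (by positivity), ← Real.rpow_mul (hw0 n), ← Real.rpow_mul (hτ n).1,
      div_mul_cancel₀ _ hq0.ne', div_mul_cancel₀ _ hq0.ne']
  have hB : ∀ n, (w n ^ (σ / q) * τ n ^ (1 - p / q)) ^ (q / m) =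
      w n ^ (σ / m) * τ n ^ κ := by
    intro n
    have := hw0 n
    have := (hτ n).1
    rw [Real.mul_rpow (by positivity) (by positivity), ← Real.rpow_mul (hw0 n),
      ← Real.rpow_mul (hτ n).1]
    congr 2
    · field_simp
    · rw [hκ]; field_simp
  simp_rw [hsplit]
  refine (rpow_sum_mul_le (by linarith) _ _ _ (fun n => ?_) (fun n => ?_)).trans ?_
  · exact mul_nonneg (hβ n) (mul_nonneg (Real.rpow_nonneg (hw0 n) _) (Real.rpow_nonneg (hτ n).1 _))
  · exact mul_nonneg (Real.rpow_nonneg (hw0 n) _) (Real.rpow_nonneg (hτ n).1 _)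
  simp_rw [hA, ← hm, hB]
  have hτκ : ∀ n, τ n ^ κ ∈ Icc (0 : ℝ) 1 := fun n =>
    ⟨Real.rpow_nonneg (hτ n).1 _, Real.rpow_le_one (hτ n).1 (hτ n).2 hκ0.le⟩
  have hY : 0 ≤ ∑ n ∈ Finset.range N, β n ^ q * (w n ^ (1 - σ) * τ n ^ p) :=
    Finset.sum_nonneg fun n _ => mul_nonneg (Real.rpow_nonneg (hβ n) _)
      (mul_nonneg (Real.rpow_nonneg (hw0 n) _) (Real.rpow_nonneg (hτ n).1 _))
  refine (mul_le_mul_of_nonneg_left (hS w hw _ hτκ N) hY).trans ?_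
  rw [mul_left_comm, Finset.sum_mul_sum]
  refine mul_le_mul_of_nonneg_left
    (Finset.sum_le_sum fun n _ => Finset.sum_le_sum fun k _ => ?_) hC
  have hβn := Real.rpow_nonneg (hβ n) q
  rw [mul_assoc]
  refine mul_le_mul_of_nonneg_left ?_ hβn
  refine le_trans ?_ (hw.rpow_mul_rpow_le hr hτ hp hσ0 hσ1 n k)
  have hwn := hw0 n
  have hwk := hw0 k
  have hτn := (hτ n).1
  have hτk := (hτ k).1
  rw [div_mul_cancel₀ _ hq1.ne', ← Real.rpow_mul hτk]
  have : τ k ^ (κ * min m 1) ≤ τ k ^ (p * (2 * σ)) :=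
    Real.rpow_le_rpow_of_exponent_ge_of_imp hτk (hτ k).2 hσ2 (fun _ h => absurd h (by positivity))
  calc _ = w n ^ (1 - σ) * w k ^ σ * (τ n ^ p * τ k ^ (κ * min m 1)) := by ring
    _ ≤ _ := by gcongr

/-! ### Norms of `ℓ^q` and `L^q` as extended nonnegative sums and integrals -/

/-- The sequence space `ℓ^q` over `ℂ`. -/
noncomputable abbrev SeqLp (q : ℝ) := lp (fun _ : ℕ => ℂ) (ENNReal.ofReal q)

theorem enorm_rpow_seqLp {q : ℝ} [Fact (1 ≤ ENNReal.ofReal q)] (hq : 0 < q) (b : SeqLp q) :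
    ‖b‖ₑ ^ q = ∑' n, ‖b n‖ₑ ^ q := by
  have ht : (ENNReal.ofReal q).toReal = q := ENNReal.toReal_ofReal hq.le
  have h := lp.norm_rpow_eq_tsum (p := ENNReal.ofReal q) (by rw [ht]; exact hq) b
  have hs := (lp.memℓp b).summable (by rw [ht]; exact hq)
  rw [ht] at h hs
  rw [← ofReal_norm, ENNReal.ofReal_rpow_of_nonneg (norm_nonneg _) hq.le, h,
    ENNReal.ofReal_tsum_of_nonneg (fun n => by positivity) hs]
  refine tsum_congr fun n => ?_
  rw [← ofReal_norm, ENNReal.ofReal_rpow_of_nonneg (norm_nonneg _) hq.le]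

theorem memℓp_of_tsum_enorm_rpow_ne_top {q : ℝ} (hq : 0 < q) {b : ℕ → ℂ}
    (h : ∑' n, ‖b n‖ₑ ^ q ≠ ∞) : Memℓp b (ENNReal.ofReal q) := by
  refine memℓp_gen ?_
  rw [ENNReal.toReal_ofReal hq.le]
  refine (ENNReal.summable_toReal h).congr fun n => ?_
  rw [← ENNReal.toReal_rpow, toReal_enorm]

theorem enorm_rpow_lp {q : ℝ} (hq : 0 < q) {μ : Measure ℝ} (f : LpC q μ) :
    ‖f‖ₑ ^ q = ∫⁻ t, ‖f t‖ₑ ^ q ∂μ := by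
  rw [Lp.enorm_def, eLpNorm_eq_lintegral_rpow_enorm_toReal (by simpa using hq)
    ENNReal.ofReal_ne_top, ENNReal.toReal_ofReal hq.le, ← ENNReal.rpow_mul,
    one_div_mul_cancel hq.ne', ENNReal.rpow_one]

theorem memLp_of_lintegral_ne_top {q : ℝ} (hq : 0 < q) {μ : Measure ℝ} {F : ℝ → ℂ}
    (hF : AEStronglyMeasurable F μ) (h : ∫⁻ t, ‖F t‖ₑ ^ q ∂μ ≠ ∞) :
    MemLp F (ENNReal.ofReal q) μ := by
  refine ⟨hF, ?_⟩
  rw [eLpNorm_eq_lintegral_rpow_enorm_toReal (by simpa using hq)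
    ENNReal.ofReal_ne_top, ENNReal.toReal_ofReal hq.le]
  exact ENNReal.rpow_lt_top_of_nonneg (by positivity) h

theorem norm_le_of_enorm_rpow_le {E F : Type*} [SeminormedAddCommGroup E]
    [SeminormedAddCommGroup F] {q : ℝ} (hq : 0 < q) {c : ℝ≥0} {x : E} {y : F}
    (h : ‖x‖ₑ ^ q ≤ c * ‖y‖ₑ ^ q) : ‖x‖ ≤ (c ^ (1 / q) : ℝ≥0) * ‖y‖ := by
  have h1 := ENNReal.rpow_le_rpow h (z := 1 / q) (by positivity)
  rw [ENNReal.mul_rpow_of_nonneg _ _ (by positivity), ← ENNReal.rpow_mul, ← ENNReal.rpow_mul,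
    mul_one_div_cancel hq.ne', ENNReal.rpow_one, ENNReal.rpow_one,
    ← ENNReal.coe_rpow_of_nonneg _ (by positivity)] at h1
  have h2 := ENNReal.toReal_mono (by finiteness) h1
  simpa using h2

/-- The kernel `ρ ^ |n - k|` has uniformly bounded row sums. -/
theorem tsum_pow_dist_le (x : ℝ≥0∞) (n : ℕ) :
    ∑' k, x ^ (n - k + (k - n)) ≤ 2 * (1 - x)⁻¹ := by
  rw [← ENNReal.summable.sum_add_tsum_nat_add' (f := fun k => x ^ (n - k + (k - n))) (k := n),
    two_mul]
  refine add_le_add ?_ (le_of_eq ?_)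
  -- Below the diagonal, `k = n - 1 - j` lies at distance `j + 1` from `n`.
  · rw [← Finset.sum_range_reflect, ← ENNReal.tsum_geometric]
    refine le_trans (Finset.sum_le_sum (g := fun j => x ^ (j + 1)) fun j hj => ?_) ?_
    · rw [Finset.mem_range] at hj
      rw [show n - (n - 1 - j) + (n - 1 - j - n) = j + 1 by omega]
    · refine le_trans (ENNReal.sum_le_tsum _) ?_
      rw [ENNReal.tsum_eq_iSup_nat]
      refine iSup_le fun N => ?_
      calc ∑ j ∈ Finset.range N, x ^ (j + 1) ≤ ∑ j ∈ Finset.range (N + 1), x ^ j := by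
            rw [Finset.sum_range_succ']; exact le_self_add
        _ ≤ _ := ENNReal.sum_le_tsum _
  · rw [← ENNReal.tsum_geometric]
    refine tsum_congr fun k => ?_
    congr 1
    omega

/-! ### Integrated Schur estimate -/

/-- `C` is a constant in the integrated Schur-type estimate for lacunary series of ratio `r`. -/
def LacunarySeriesBound (r p q : ℝ) (C : ℝ≥0) : Prop :=
  ∀ w : ℕ → ℝ, LacunaryWith r w → ∀ (μ : Measure ℝ) (τ : ℕ → ℝ → ℝ), (∀ n, Measurable (τ n)) →
    (∀ᵐ t ∂μ, ∀ n, τ n t ∈ Icc (0 : ℝ) 1) → ∀ D : ℝ≥0∞,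
    (∀ n, ∫⁻ t, ENNReal.ofReal (w n * τ n t ^ p) ∂μ ≤ D) → ∀ (b : ℕ → ℂ) (F : ℝ → ℂ),
    (∀ᵐ t ∂μ, HasSum (fun n => b n * ((w n ^ (1 / q) * τ n t : ℝ) : ℂ)) (F t)) →
    ∫⁻ t, ‖F t‖ₑ ^ q ∂μ ≤ C * D * ∑' n, ‖b n‖ₑ ^ q

theorem exists_lacunarySeriesBound {r p q : ℝ} (hr : 1 < r) (hp : 1 ≤ p) (hpq : p < q) :
    ∃ C : ℝ≥0, LacunarySeriesBound r p q C := by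
  obtain ⟨C, ρ, hC, hρ, hρ1, H⟩ := exists_rpow_lacunary_series_le hr hp hpq
  have hq : 0 < q := by linarith
  set x : ℝ≥0∞ := ENNReal.ofReal ρ with hx
  have hx1 : x < 1 := by rw [hx]; exact ENNReal.ofReal_lt_one.2 hρ1
  have hfin : ENNReal.ofReal C * (2 * (2 * (1 - x)⁻¹)) ≠ ∞ := by
    have : (1 - x)⁻¹ ≠ ∞ := ENNReal.inv_ne_top.2 (tsub_pos_of_lt hx1).ne'
    finiteness
  refine ⟨(ENNReal.ofReal C * (2 * (2 * (1 - x)⁻¹))).toNNReal, ?_⟩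
  intro w hw μ τ hτm hτ D hD b F hF
  rw [ENNReal.coe_toNNReal hfin]
  set φ : ℕ → ℝ → ℝ≥0∞ := fun n t => ENNReal.ofReal (w n * τ n t ^ p) with hφ
  have hφm : ∀ n, Measurable (φ n) := fun n => by
    have := hτm n
    fun_prop
  have hpt : ∀ᵐ t ∂μ, ‖F t‖ₑ ^ q ≤ ENNReal.ofReal C *
      ∑' n, ∑' k, ‖b n‖ₑ ^ q * (x ^ (n - k + (k - n)) * (φ n t + φ k t)) := by
    filter_upwards [hτ, hF] with t ht hFt
    have hlim := (((ENNReal.continuous_rpow_const (y := q)).comp continuous_enorm).tendsto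
      (F t)).comp hFt.tendsto_sum_nat
    -- The finite estimate is uniform in the number of terms and passes to the limit of the partial
    -- sums.
    refine le_of_tendsto hlim (Eventually.of_forall fun N => ?_)
    simp only [Function.comp]
    have h1 := H w hw (fun n => τ n t) ht (fun n => ‖b n‖) (fun n => norm_nonneg _) N
    have h2 : ‖∑ n ∈ Finset.range N, b n * ((w n ^ (1 / q) * τ n t : ℝ) : ℂ)‖ ≤
        ∑ n ∈ Finset.range N, ‖b n‖ * (w n ^ (1 / q) * τ n t) := by
      refine (norm_sum_le _ _).trans (le_of_eq (Finset.sum_congr rfl fun n _ => ?_))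
      rw [norm_mul, Complex.norm_real, Real.norm_of_nonneg]
      exact mul_nonneg (Real.rpow_nonneg (hw.1 n).le _) (ht n).1
    rw [← ofReal_norm, ENNReal.ofReal_rpow_of_nonneg (norm_nonneg _) hq.le]
    refine (ENNReal.ofReal_le_ofReal
      ((Real.rpow_le_rpow (norm_nonneg _) h2 hq.le).trans h1)).trans ?_
    have hw0 := fun n => (hw.1 n).le
    have hΦ : ∀ n, 0 ≤ w n * τ n t ^ p := fun n =>
      mul_nonneg (hw0 n) (Real.rpow_nonneg (ht n).1 _)
    have hterm : ∀ n k, 0 ≤ ‖b n‖ ^ q * (ρ ^ (n - k + (k - n)) *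
        (w n * τ n t ^ p + w k * τ k t ^ p)) := fun n k => by
      have := hΦ n
      have := hΦ k
      positivity
    rw [ENNReal.ofReal_mul hC]
    refine mul_le_mul_right ?_ _
    rw [ENNReal.ofReal_sum_of_nonneg fun n _ => Finset.sum_nonneg fun k _ => hterm n k]
    refine le_trans (Finset.sum_le_sum fun n _ => ?_) (ENNReal.sum_le_tsum (Finset.range N))
    rw [ENNReal.ofReal_sum_of_nonneg fun k _ => hterm n k]
    refine le_trans (Finset.sum_le_sum fun k _ => le_of_eq ?_)
      (ENNReal.sum_le_tsum (Finset.range N))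
    rw [ENNReal.ofReal_mul (by positivity), ENNReal.ofReal_mul (by positivity),
      ENNReal.ofReal_add (hΦ n) (hΦ k), ENNReal.ofReal_pow hρ.le, ← ofReal_norm,
      ENNReal.ofReal_rpow_of_nonneg (norm_nonneg _) hq.le]
  refine (lintegral_mono_ae hpt).trans ?_
  have hm : ∀ n k, Measurable fun t =>
      ‖b n‖ₑ ^ q * (x ^ (n - k + (k - n)) * (φ n t + φ k t)) := fun n k =>
    (((hφm n).add (hφm k)).const_mul _).const_mul _
  rw [lintegral_const_mul _ (Measurable.tsum fun n => Measurable.tsum (hm n)),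
    lintegral_tsum fun n => (Measurable.tsum (hm n)).aemeasurable]
  have hrow : ∀ n, ∫⁻ t, ∑' k, ‖b n‖ₑ ^ q * (x ^ (n - k + (k - n)) * (φ n t + φ k t)) ∂μ ≤
      ‖b n‖ₑ ^ q * ((2 * (1 - x)⁻¹) * (2 * D)) := fun n => by
    rw [lintegral_tsum fun k => (hm n k).aemeasurable]
    calc _ ≤ ∑' k, ‖b n‖ₑ ^ q * (x ^ (n - k + (k - n)) * (2 * D)) := by
          refine ENNReal.tsum_le_tsum fun k => ?_
          have h1 : Measurable fun t => φ n t + φ k t := (hφm n).add (hφm k)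
          rw [lintegral_const_mul _ (h1.const_mul _), lintegral_const_mul _ h1,
            lintegral_add_left (hφm n), two_mul]
          gcongr
          · exact hD n
          · exact hD k
      _ ≤ _ := by
          rw [ENNReal.tsum_mul_left, ENNReal.tsum_mul_right]
          gcongr
          exact tsum_pow_dist_le x n
  calc _ ≤ ENNReal.ofReal C * ∑' n, ‖b n‖ₑ ^ q * ((2 * (1 - x)⁻¹) * (2 * D)) := by
        gcongr with n
        exact hrow n
    _ = _ := by
        rw [ENNReal.tsum_mul_right]; ring

/-! ### The synthesis operator: boundedness and compactness -/

section Synthesis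

variable {r p q : ℝ} {w : ℕ → ℝ} {μ : Measure ℝ} {τ : ℕ → ℝ → ℝ}

theorem summable_coeff_mul [Fact (1 ≤ ENNReal.ofReal q)] {u : ℕ → ℝ} (hu : Summable u)
    (hu0 : ∀ n, 0 ≤ u n) (b : SeqLp q) : Summable fun n => b n * (u n : ℂ) := by
  refine Summable.of_norm_bounded (hu.mul_left ‖b‖) fun n => ?_
  rw [norm_mul, Complex.norm_real, Real.norm_of_nonneg (hu0 n)]
  exact mul_le_mul_of_nonneg_right (lp.norm_apply_le_norm
    (zero_lt_one.trans_le (Fact.out : 1 ≤ ENNReal.ofReal q)).ne' b n) (hu0 n)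

/-- Boundedness of the synthesis operator `b ↦ ∑ bₙ wₙ^(1/q) τₙ` from `ℓ^q` to `L^q(μ)`. -/
theorem exists_synthesis [Fact (1 ≤ ENNReal.ofReal q)] (hq : 0 < q) {C : ℝ≥0}
    (hC : LacunarySeriesBound r p q C) (hw : LacunaryWith r w) (hτm : ∀ n, Measurable (τ n))
    (hτ : ∀ᵐ t ∂μ, ∀ n, τ n t ∈ Icc (0 : ℝ) 1)
    (hs : ∀ᵐ t ∂μ, Summable fun n => w n ^ (1 / q) * τ n t) {D : ℝ≥0}
    (hD : ∀ n, ∫⁻ t, ENNReal.ofReal (w n * τ n t ^ p) ∂μ ≤ D) :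
    ∃ T : SeqLp q →L[ℂ] LpC q μ, ∀ b : SeqLp q,
      T b =ᵐ[μ] fun t => ∑' n, b n * ((w n ^ (1 / q) * τ n t : ℝ) : ℂ) := by
  set S : SeqLp q → ℝ → ℂ := fun b t => ∑' n, b n * ((w n ^ (1 / q) * τ n t : ℝ) : ℂ) with hS
  have hsum : ∀ᵐ t ∂μ, ∀ b : SeqLp q,
      HasSum (fun n => b n * ((w n ^ (1 / q) * τ n t : ℝ) : ℂ)) (S b t) := by
    filter_upwards [hτ, hs] with t ht hst b
    exact (summable_coeff_mul hst (fun n => mul_nonneg (Real.rpow_nonneg (hw.1 n).le _)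
      (ht n).1) b).hasSum
  have hbd : ∀ b : SeqLp q, ∫⁻ t, ‖S b t‖ₑ ^ q ∂μ ≤ (C * D : ℝ≥0) * ‖b‖ₑ ^ q := fun b => by
    rw [enorm_rpow_seqLp hq, ENNReal.coe_mul]
    refine hC w hw μ τ hτm hτ D hD b (S b) ?_
    filter_upwards [hsum] with t ht using ht b
  have hmeas : ∀ b : SeqLp q, AEStronglyMeasurable (S b) μ := fun b => by
    refine aestronglyMeasurable_of_tendsto_ae atTop
      (f := fun N t => ∑ n ∈ Finset.range N, b n * ((w n ^ (1 / q) * τ n t : ℝ) : ℂ)) ?_ ?_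
    · intro N
      refine Measurable.aestronglyMeasurable ?_
      fun_prop
    · filter_upwards [hsum] with t ht using (ht b).tendsto_sum_nat
  have hmem : ∀ b : SeqLp q, MemLp (S b) (ENNReal.ofReal q) μ := fun b => by
    refine memLp_of_lintegral_ne_top hq (hmeas b) (ne_top_of_le_ne_top ?_ (hbd b))
    have : ‖b‖ₑ ^ q ≠ ∞ := ENNReal.rpow_ne_top_of_nonneg hq.le enorm_ne_top
    finiteness
  let L : SeqLp q →ₗ[ℂ] LpC q μ :=
    { toFun := fun b => (hmem b).toLp (S b)
      map_add' := fun a b => by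
        rw [← MemLp.toLp_add, MemLp.toLp_eq_toLp_iff]
        filter_upwards [hsum] with t ht
        refine (ht (a + b)).unique ?_
        simpa [add_mul] using (ht a).add (ht b)
      map_smul' := fun c b => by
        rw [RingHom.id_apply, ← MemLp.toLp_const_smul, MemLp.toLp_eq_toLp_iff]
        filter_upwards [hsum] with t ht
        refine (ht (c • b)).unique ?_
        simpa [mul_assoc] using (ht b).mul_left c }
  refine ⟨L.mkContinuous ((C * D) ^ (1 / q) : ℝ≥0) fun b => ?_, fun b => (hmem b).coeFn_toLp⟩
  refine norm_le_of_enorm_rpow_le hq ?_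
  rw [enorm_rpow_lp hq]
  refine le_trans (le_of_eq (lintegral_congr_ae ?_)) (hbd b)
  filter_upwards [(hmem b).coeFn_toLp] with t ht
  change ‖((hmem b).toLp (S b) : ℝ → ℂ) t‖ₑ ^ q = _
  rw [ht]

theorem isCompactOperator_smulRight {E F : Type*} [NormedAddCommGroup E] [NormedSpace ℂ E]
    [NormedAddCommGroup F] [NormedSpace ℂ F] (c : E →L[ℂ] ℂ) (f : F) :
    IsCompactOperator (c.smulRight f : E →L[ℂ] F) := by
  have h : IsCompactOperator (ContinuousLinearMap.toSpanSingleton ℂ f) :=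
    isCompactOperator_of_locallyCompactSpace_rng _
  exact h.comp_clm c

theorem isCompactOperator_finsetSum {E F ι : Type*} [NormedAddCommGroup E] [NormedSpace ℂ E]
    [NormedAddCommGroup F] [NormedSpace ℂ F] (s : Finset ι) (R : ι → E →L[ℂ] F)
    (hR : ∀ i ∈ s, IsCompactOperator (R i)) : IsCompactOperator (∑ i ∈ s, R i : E →L[ℂ] F) := by
  classical
  induction s using Finset.induction_on with
  | empty => simpa using isCompactOperator_zero
  | insert i s hi ih =>
    rw [Finset.sum_insert hi]
    exact (hR i (Finset.mem_insert_self i s)).add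
      (ih fun j hj => hR j (Finset.mem_insert_of_mem hj))

/-- The synthesis operator is compact if the test integrals tend to zero. -/
theorem isCompactOperator_synthesis [Fact (1 ≤ ENNReal.ofReal q)] (hq : 0 < q) {C : ℝ≥0}
    (hC : LacunarySeriesBound r p q C) (hw : LacunaryWith r w) (hτm : ∀ n, Measurable (τ n))
    (hτ : ∀ᵐ t ∂μ, ∀ n, τ n t ∈ Icc (0 : ℝ) 1)
    (hs : ∀ᵐ t ∂μ, Summable fun n => w n ^ (1 / q) * τ n t)
    (hD : Tendsto (fun n => ∫⁻ t, ENNReal.ofReal (w n * τ n t ^ p) ∂μ) atTop (𝓝 0))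
    {T : SeqLp q →L[ℂ] LpC q μ} (hT : ∀ b : SeqLp q,
      T b =ᵐ[μ] fun t => ∑' n, b n * ((w n ^ (1 / q) * τ n t : ℝ) : ℂ)) :
    IsCompactOperator T := by
  -- `R N` is synthesis of the first `N` coordinates, of finite rank; the difference from `T` is
  -- synthesis of the tail.
  let R : ℕ → SeqLp q →L[ℂ] LpC q μ := fun N => ∑ n ∈ Finset.range N,
    (lp.evalCLM ℂ (fun _ : ℕ => ℂ) (ENNReal.ofReal q) n).smulRight
      (T (lp.single (ENNReal.ofReal q) n 1))
  refine isCompactOperator_of_tendsto (F := R) (l := atTop) ?_ (Eventually.of_forall fun N =>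
    isCompactOperator_finsetSum _ _ fun n _ => isCompactOperator_smulRight _ _)
  rw [tendsto_iff_norm_sub_tendsto_zero]
  -- `toNNReal` sends an infinite supremum to 0, so the bound is proved only for large `N`, where
  -- the test integrals are at most 1.
  refine squeeze_zero' (Eventually.of_forall fun N => norm_nonneg _) ?_
    (g := fun N => (((C * (⨆ n, ∫⁻ t, ENNReal.ofReal (w (n + N) * τ (n + N) t ^ p) ∂μ).toNNReal)
      ^ (1 / q) : ℝ≥0) : ℝ)) ?_
  · have hev : ∀ᶠ n in atTop, ∫⁻ t, ENNReal.ofReal (w n * τ n t ^ p) ∂μ ≤ 1 :=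
      hD.eventually_le_const one_pos
    obtain ⟨N₀, hN₀⟩ := eventually_atTop.1 hev
    filter_upwards [eventually_ge_atTop N₀] with N hN
    set D := ⨆ n, ∫⁻ t, ENNReal.ofReal (w (n + N) * τ (n + N) t ^ p) ∂μ with hDdef
    have hDtop : D ≠ ∞ := ne_top_of_le_ne_top ENNReal.one_ne_top
      (iSup_le fun n => hN₀ _ (by omega))
    rw [← norm_neg, neg_sub]
    refine ContinuousLinearMap.opNorm_le_bound _ (NNReal.coe_nonneg _) fun b => ?_
    refine norm_le_of_enorm_rpow_le hq ?_
    set b' : SeqLp q := b - ∑ n ∈ Finset.range N, lp.single (ENNReal.ofReal q) n (b n) with hb'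
    have hbn : ∀ n, b' n = if n < N then 0 else b n := fun n => by
      have h1 : (∑ i ∈ Finset.range N, lp.single (E := fun _ : ℕ => ℂ) (ENNReal.ofReal q) i (b i) :
          SeqLp q) n = ∑ i ∈ Finset.range N,
            (lp.single (E := fun _ : ℕ => ℂ) (ENNReal.ofReal q) i (b i) : SeqLp q) n := by
        rw [lp.coeFn_sum, Finset.sum_apply]
      rw [hb', lp.coeFn_sub, Pi.sub_apply, h1]
      simp only [lp.single_apply, Pi.single_apply, Finset.sum_ite_eq, Finset.mem_range]
      split_ifs <;> simp
    have hTR : (T - R N) b = T b' := by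
      rw [hb', map_sub, map_sum, sub_apply, sum_apply]
      congr 1
      refine Finset.sum_congr rfl fun n _ => ?_
      rw [ContinuousLinearMap.smulRight_apply, ← map_smul, ← lp.single_smul, smul_eq_mul, mul_one]
      rfl
    rw [hTR, enorm_rpow_lp hq, ENNReal.coe_mul, ENNReal.coe_toNNReal hDtop]
    -- The shifted sequence has the same ratio, so the same `C` serves every tail.
    refine (hC _ (hw.shift N) μ (fun n => τ (n + N)) (fun n => hτm _)
      (hτ.mono fun t ht n => ht _) D (fun n => le_iSup
        (fun n => ∫⁻ t, ENNReal.ofReal (w (n + N) * τ (n + N) t ^ p) ∂μ) n)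
      (fun n => b' (n + N)) (T b') ?_).trans ?_
    · filter_upwards [hT b', hτ, hs] with t ht h1 h2
      rw [ht]
      have h3 := (summable_coeff_mul h2 (fun n => mul_nonneg (Real.rpow_nonneg (hw.1 n).le _)
        (h1 n).1) b').hasSum
      have h4 := (hasSum_nat_add_iff' N).2 h3
      rw [Finset.sum_eq_zero, sub_zero] at h4
      · exact h4
      · intro n hn
        rw [hbn, if_pos (Finset.mem_range.1 hn), zero_mul]
    · refine mul_le_mul_right ?_ _
      rw [enorm_rpow_seqLp hq]
      have : ∀ n, b' (n + N) = b (n + N) := fun n => by rw [hbn, if_neg (by omega)]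
      simp_rw [this]
      exact ENNReal.tsum_comp_le_tsum_of_injective (add_left_injective N) fun n => ‖b n‖ₑ ^ q
  · have h0 : Tendsto (fun N => ⨆ n, ∫⁻ t, ENNReal.ofReal (w (n + N) * τ (n + N) t ^ p) ∂μ)
        atTop (𝓝 0) := by
      rw [ENNReal.tendsto_atTop_zero] at hD ⊢
      intro ε hε
      obtain ⟨N, hN⟩ := hD ε hε
      exact ⟨N, fun n hn => iSup_le fun k => hN _ (by omega)⟩
    have h1 := (ENNReal.tendsto_toNNReal ENNReal.zero_ne_top).comp h0
    have h2 : Tendsto (fun x : ℝ≥0 => (((C * x) ^ (1 / q) : ℝ≥0) : ℝ)) (𝓝 0) (𝓝 0) := by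
      have hc : Continuous fun x : ℝ≥0 => (((C * x) ^ (1 / q) : ℝ≥0) : ℝ) :=
        NNReal.continuous_coe.comp ((NNReal.continuous_rpow_const (by positivity)).comp
          (continuous_const.mul continuous_id))
      have := hc.tendsto 0
      rwa [mul_zero, NNReal.zero_rpow (by positivity), NNReal.coe_zero] at this
    exact h2.comp h1

end Synthesis

/-! ### The peak kernel, its Laplace transform and its decay -/

/-- The kernel whose Laplace transform at `z` is `(4 z / (1 + z) ^ 2) ^ (M + 2)`. -/
noncomputable def peakKernel (M : ℕ) (s : ℝ) : ℝ :=
  4 ^ (M + 2) * ∑ j ∈ Finset.range (M + 3), (-1) ^ j * ((M + 2).choose j : ℝ) *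
    (s ^ (M + 1 + j) / ((M + 1 + j).factorial : ℝ) * Real.exp (-s))

theorem continuous_peakKernel (M : ℕ) : Continuous (peakKernel M) := by
  unfold peakKernel; fun_prop

theorem integrableOn_pow_mul_exp_neg {a : ℝ} (ha : 0 < a) (k : ℕ) :
    IntegrableOn (fun s => s ^ k * Real.exp (-(a * s))) (Ioi 0) := by
  have h := integrableOn_rpow_mul_exp_neg_mul_rpow (p := 1) (s := k) (b := a)
    (by linarith [(Nat.cast_nonneg k : (0 : ℝ) ≤ k)]) one_pos ha
  refine h.congr_fun (fun s _ => ?_) measurableSet_Ioi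
  simp

theorem integral_pow_mul_exp_neg {a : ℝ} (ha : 0 < a) (k : ℕ) :
    ∫ s in Ioi (0 : ℝ), s ^ k * Real.exp (-(a * s)) = k.factorial / a ^ (k + 1) := by
  have h := Real.integral_rpow_mul_exp_neg_mul_Ioi (a := k + 1) (r := a) (by positivity) ha
  rw [Real.Gamma_nat_eq_factorial] at h
  have e : ∀ s : ℝ, s ^ ((k : ℝ) + 1 - 1) = s ^ k := fun s => by
    rw [add_sub_cancel_right, Real.rpow_natCast]
  simp_rw [e] at h
  rw [h, ← Nat.cast_succ, Real.rpow_natCast, one_div, inv_pow, inv_mul_eq_div]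

/-- Since `s ^ k / k! * exp (-s)` has Laplace transform `(1 + z) ^ (-(k + 1))`, the alternating
binomial sum gives `(1 + z) ^ (-(M + 2)) * (1 - 1 / (1 + z)) ^ (M + 2)`, evaluated at `z = a / c`.
-/
theorem integral_exp_mul_peakKernel (M : ℕ) {a c : ℝ} (ha : 0 < a) (hc : 0 < c) :
    ∫ s in Ioi (0 : ℝ), Real.exp (-(a * s)) * (c * peakKernel M (c * s)) =
      (4 * a * c / (a + c) ^ 2) ^ (M + 2) := by
  have hac : 0 < a + c := by linarith
  have h1 : ∀ s, Real.exp (-(a * s)) * (c * peakKernel M (c * s)) =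
      ∑ j ∈ Finset.range (M + 3), 4 ^ (M + 2) * (-1) ^ j * ((M + 2).choose j : ℝ) *
        (c ^ (M + 2 + j) / ((M + 1 + j).factorial : ℝ)) *
          (s ^ (M + 1 + j) * Real.exp (-((a + c) * s))) := fun s => by
    rw [peakKernel, Finset.mul_sum, Finset.mul_sum, Finset.mul_sum]
    refine Finset.sum_congr rfl fun j _ => ?_
    rw [show -((a + c) * s) = -(a * s) + -(c * s) by ring, Real.exp_add, mul_pow,
      show M + 2 + j = M + 1 + j + 1 by ring, pow_succ c]
    ring
  simp_rw [h1]
  rw [integral_finsetSum _ fun j _ => (integrableOn_pow_mul_exp_neg hac _).const_mul _]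
  simp_rw [integral_const_mul, integral_pow_mul_exp_neg hac]
  have h2 : (4 * a * c / (a + c) ^ 2) ^ (M + 2) =
      4 ^ (M + 2) * (c / (a + c)) ^ (M + 2) * (-(c / (a + c)) + 1) ^ (M + 2) := by
    rw [← mul_pow, ← mul_pow]
    congr 1
    field_simp
    ring
  rw [h2, add_pow, Finset.mul_sum]
  refine Finset.sum_congr rfl fun j _ => ?_
  have hf : ((M + 1 + j).factorial : ℝ) ≠ 0 := by positivity
  rw [neg_pow (c / (a + c)), one_pow, div_pow, div_pow, show M + 1 + j + 1 = M + 2 + j by ring, pow_add c,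
    pow_add (a + c)]
  field_simp

/-- Half of the exponential absorbs the polynomial growth. One factor `s` is kept: vanishing at 0 is
what makes sums over lacunary dilates converge uniformly. -/
theorem exists_abs_peakKernel_le (M : ℕ) : ∃ K : ℝ, 0 ≤ K ∧ ∀ s, 0 ≤ s →
    |peakKernel M s| ≤ K * (s * Real.exp (-(2⁻¹ * s))) := by
  refine ⟨4 ^ (M + 2) * ∑ j ∈ Finset.range (M + 3), ((M + 2).choose j : ℝ) * 2 ^ (M + j),
    by positivity, fun s hs => ?_⟩
  rw [peakKernel, abs_mul, abs_of_nonneg (by positivity : (0 : ℝ) ≤ 4 ^ (M + 2)), mul_assoc,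
    Finset.sum_mul]
  refine mul_le_mul_of_nonneg_left ?_ (by positivity)
  refine (Finset.abs_sum_le_sum_abs _ _).trans (Finset.sum_le_sum fun j _ => ?_)
  rw [abs_mul, abs_mul, abs_pow, abs_neg, abs_one, one_pow, one_mul, Nat.abs_cast, mul_assoc,
    abs_of_nonneg (by positivity)]
  refine mul_le_mul_of_nonneg_left ?_ (by positivity)
  have h1 := Real.pow_div_factorial_le_exp (2⁻¹ * s) (by positivity) (M + j)
  have h2 : Real.exp (-s) = Real.exp (-(2⁻¹ * s)) * Real.exp (-(2⁻¹ * s)) := by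
    rw [← Real.exp_add]; ring_nf
  have h3 : Real.exp (2⁻¹ * s) * Real.exp (-(2⁻¹ * s)) = 1 := by rw [← Real.exp_add]; simp
  have h4 : (M + j).factorial ≤ (M + 1 + j).factorial := Nat.factorial_le (by omega)
  have h5 : s ^ (M + j) / ((M + 1 + j).factorial : ℝ) ≤ 2 ^ (M + j) * Real.exp (2⁻¹ * s) := by
    calc s ^ (M + j) / ((M + 1 + j).factorial : ℝ) ≤ s ^ (M + j) / ((M + j).factorial : ℝ) := by
          gcongr
      _ = 2 ^ (M + j) * ((2⁻¹ * s) ^ (M + j) / ((M + j).factorial : ℝ)) := by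
          rw [mul_pow, inv_pow]; field_simp
      _ ≤ _ := by gcongr
  calc s ^ (M + 1 + j) / ((M + 1 + j).factorial : ℝ) * Real.exp (-s)
      = s * Real.exp (-(2⁻¹ * s)) * Real.exp (-(2⁻¹ * s)) *
          (s ^ (M + j) / ((M + 1 + j).factorial : ℝ)) := by
        rw [h2, show M + 1 + j = M + j + 1 by ring, pow_succ]; ring
    _ ≤ s * Real.exp (-(2⁻¹ * s)) * Real.exp (-(2⁻¹ * s)) *
          (2 ^ (M + j) * Real.exp (2⁻¹ * s)) := by gcongr
    _ = 2 ^ (M + j) * (s * Real.exp (-(2⁻¹ * s))) *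
          (Real.exp (2⁻¹ * s) * Real.exp (-(2⁻¹ * s))) := by ring
    _ = _ := by rw [h3, mul_one]

/-- Exponential decay is faster than quadratic decay. -/
theorem mul_exp_neg_le {s : ℝ} (hs : 0 ≤ s) :
    s * Real.exp (-(2⁻¹ * s)) ≤ 16 * (s / (1 + s) ^ 2) := by
  -- Square `1 + s/4 ≤ exp (s/4)` and multiply by 16: the left side becomes `(4 + s) ^ 2`.
  have h1 : (1 + s) ^ 2 ≤ 16 * Real.exp (2⁻¹ * s) := by
    have := Real.add_one_le_exp (4⁻¹ * s)
    have h2 : Real.exp (2⁻¹ * s) = Real.exp (4⁻¹ * s) ^ 2 := by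
      rw [← Real.exp_nat_mul]; congr 1; push_cast; ring
    rw [h2]
    nlinarith
  rw [Real.exp_neg, mul_div_assoc', le_div_iff₀ (by positivity)]
  have h0 := Real.exp_pos (2⁻¹ * s)
  calc s * (Real.exp (2⁻¹ * s))⁻¹ * (1 + s) ^ 2
      ≤ s * (Real.exp (2⁻¹ * s))⁻¹ * (16 * Real.exp (2⁻¹ * s)) := by gcongr
    _ = 16 * s := by field_simp

/-- Telescoping of `x / (1 + x)`, which increases from 0 to 1: passing from `x` to at least `r * x`
raises it by at least `(r - 1) / r` times `x / (1 + x) ^ 2`. -/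
theorem LacunaryWith.sum_div_one_add_sq_le {r : ℝ} (hr : 1 < r) {w : ℕ → ℝ}
    (hw : LacunaryWith r w) {s : ℝ} (hs : 0 ≤ s) (N : ℕ) :
    ∑ n ∈ Finset.range N, w n * s / (1 + w n * s) ^ 2 ≤ r / (r - 1) := by
  have hr1 : 0 < r - 1 := by linarith
  have hx : ∀ n, 0 ≤ w n * s := fun n => mul_nonneg (hw.1 n).le hs
  have hstep : ∀ n, w n * s / (1 + w n * s) ^ 2 ≤ r / (r - 1) *
      (w (n + 1) * s / (1 + w (n + 1) * s) - w n * s / (1 + w n * s)) := fun n => by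
    have h0 := hx n
    have h1 : r * (w n * s) ≤ w (n + 1) * s := by
      rw [← mul_assoc]; exact mul_le_mul_of_nonneg_right (hw.2 n) hs
    generalize w n * s = x at h0 h1
    generalize w (n + 1) * s = y at h1
    have hy : 0 ≤ y := le_trans (by positivity) h1
    have h2 : r * x / (1 + r * x) ≤ y / (1 + y) := by
      rw [div_le_div_iff₀ (by positivity) (by positivity)]; nlinarith
    have h3 : r * x / (1 + r * x) - x / (1 + x) = (r - 1) * x / ((1 + r * x) * (1 + x)) := by
      field_simp; ring
    calc x / (1 + x) ^ 2 ≤ r * x / ((1 + r * x) * (1 + x)) := by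
          rw [div_le_div_iff₀ (by positivity) (by positivity)]
          have : 0 ≤ x * (1 + x) * (r - 1) := by positivity
          nlinarith
      _ = r / (r - 1) * (r * x / (1 + r * x) - x / (1 + x)) := by
          rw [h3]; field_simp
      _ ≤ _ := by gcongr
  refine (Finset.sum_le_sum fun n _ => hstep n).trans ?_
  rw [← Finset.mul_sum, Finset.sum_range_sub (fun n => w n * s / (1 + w n * s))]
  refine mul_le_of_le_one_right (by positivity) ?_
  have h1 : w N * s / (1 + w N * s) ≤ 1 := by
    rw [div_le_one (by linarith [hx N])]; linarith
  have h2 : 0 ≤ w 0 * s / (1 + w 0 * s) := div_nonneg (hx 0) (by linarith [hx 0])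
  linarith

/-! ### The substitution `s = log (1/t)` and a weighted Hölder inequality -/

theorem image_neg_log_Ioo : (fun t : ℝ => -Real.log t) '' Ioo 0 1 = Ioi 0 := by
  ext s
  constructor
  · rintro ⟨t, ht, rfl⟩
    exact neg_pos.2 (Real.log_neg ht.1 ht.2)
  · intro hs
    exact ⟨Real.exp (-s), ⟨Real.exp_pos _, by simpa using hs⟩, by simp⟩

theorem hasDerivWithinAt_neg_log (t : ℝ) (ht : t ∈ Ioo (0 : ℝ) 1) :
    HasDerivWithinAt (fun t : ℝ => -Real.log t) (-t⁻¹) (Ioo 0 1) t :=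
  (Real.hasDerivAt_log ht.1.ne').neg.hasDerivWithinAt

theorem injOn_neg_log : InjOn (fun t : ℝ => -Real.log t) (Ioo 0 1) := fun _ ha _ hb h =>
  Real.log_injOn_pos (mem_Ioi.2 ha.1) (mem_Ioi.2 hb.1) (neg_injective h)

theorem integral_Ioo_comp_neg_log (g : ℝ → ℝ) :
    ∫ t in Ioo (0 : ℝ) 1, t⁻¹ * g (-Real.log t) = ∫ s in Ioi (0 : ℝ), g s := by
  rw [← image_neg_log_Ioo, integral_image_eq_integral_abs_deriv_smul measurableSet_Ioo
    hasDerivWithinAt_neg_log injOn_neg_log]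
  refine setIntegral_congr_fun measurableSet_Ioo fun t ht => ?_
  simp only [smul_eq_mul, abs_neg, abs_inv, abs_of_pos ht.1]

theorem lintegral_Ioo_comp_neg_log (g : ℝ → ℝ) :
    ∫⁻ t in Ioo (0 : ℝ) 1, ENNReal.ofReal (t⁻¹ * g (-Real.log t)) =
      ∫⁻ s in Ioi (0 : ℝ), ENNReal.ofReal (g s) := by
  rw [← image_neg_log_Ioo, lintegral_image_eq_lintegral_abs_deriv_mul measurableSet_Ioo
    hasDerivWithinAt_neg_log injOn_neg_log]
  refine setLIntegral_congr_fun measurableSet_Ioo fun t ht => ?_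
  have := ht.1
  simp only [abs_neg, abs_inv, abs_of_pos ht.1]
  rw [← ENNReal.ofReal_mul (by positivity)]

/-- In the variable `s` the dilation by `c` preserves the `L^1` norm, so the bound does not depend
on `c`. -/
theorem lintegral_dilated_peakKernel_le {M : ℕ} {K : ℝ} (hK : 0 ≤ K) (h : ∀ s, 0 ≤ s →
    |peakKernel M s| ≤ K * (s * Real.exp (-(2⁻¹ * s)))) {c : ℝ} (hc : 0 < c) :
    ∫⁻ t in Ioo (0 : ℝ) 1, ENNReal.ofReal (t⁻¹ * (c * |peakKernel M (c * -Real.log t)|)) ≤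
      ENNReal.ofReal (4 * K) := by
  rw [lintegral_Ioo_comp_neg_log (fun s => c * |peakKernel M (c * s)|)]
  have hint := (integrableOn_pow_mul_exp_neg (a := 2⁻¹ * c) (by positivity) 1).const_mul (K * c ^ 2)
  have hval : ∫ s in Ioi (0 : ℝ), K * c ^ 2 * (s ^ 1 * Real.exp (-(2⁻¹ * c * s))) = 4 * K := by
    rw [integral_const_mul, integral_pow_mul_exp_neg (by positivity)]
    simp only [Nat.factorial_one]
    field_simp
    ring
  rw [← hval, ofReal_integral_eq_lintegral_ofReal hint
    ((ae_restrict_mem measurableSet_Ioi).mono fun s hs => ?_)]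
  · refine setLIntegral_mono' measurableSet_Ioi fun s hs => ENNReal.ofReal_le_ofReal ?_
    have hs0 : 0 < s := hs
    calc c * |peakKernel M (c * s)| ≤ c * (K * (c * s * Real.exp (-(2⁻¹ * (c * s))))) := by
          gcongr
          exact h _ (by positivity)
      _ = _ := by ring_nf
  · have hs0 : 0 < s := hs
    show 0 ≤ _
    positivity

/-- Hölder for the measure with density `k`. It serves both for the analysis kernel and, with
counting measure, for the Schur test on matrices. -/
theorem lintegral_mul_rpow_le {α : Type*} [MeasurableSpace α] (μ : Measure α) {q : ℝ} (hq : 1 < q)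
    {F k : α → ℝ≥0∞} (hF : AEMeasurable F μ) (hk : AEMeasurable k μ) :
    (∫⁻ x, F x * k x ∂μ) ^ q ≤ (∫⁻ x, F x ^ q * k x ∂μ) * (∫⁻ x, k x ∂μ) ^ (q - 1) := by
  have hq0 : 0 < q := by linarith
  have hq1 : 0 < q - 1 := by linarith
  have hc : q.HolderConjugate (q / (q - 1)) := Real.HolderConjugate.conjExponent hq
  have h := ENNReal.lintegral_mul_le_Lp_mul_Lq μ hc (f := fun x => F x * k x ^ (1 / q))
    (g := fun x => k x ^ ((q - 1) / q)) (hF.mul (hk.pow_const _)) (hk.pow_const _)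
  have e1 : ∀ x, ((fun x => F x * k x ^ (1 / q)) * fun x => k x ^ ((q - 1) / q)) x =
      F x * k x := fun x => by
    simp only [Pi.mul_apply]
    rw [mul_assoc, ← ENNReal.rpow_add_of_nonneg _ _ (by positivity) (by positivity), ← add_div,
      add_sub_cancel, div_self hq0.ne', ENNReal.rpow_one]
  have e2 : ∀ x, (F x * k x ^ (1 / q)) ^ q = F x ^ q * k x := fun x => by
    rw [ENNReal.mul_rpow_of_nonneg _ _ hq0.le, ← ENNReal.rpow_mul, one_div_mul_cancel hq0.ne',
      ENNReal.rpow_one]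
  have e3 : ∀ x, (k x ^ ((q - 1) / q)) ^ (q / (q - 1)) = k x := fun x => by
    rw [← ENNReal.rpow_mul, div_mul_div_cancel₀ hq0.ne', div_self hq1.ne', ENNReal.rpow_one]
  simp_rw [e1, e2, e3] at h
  refine (ENNReal.rpow_le_rpow h hq0.le).trans (le_of_eq ?_)
  rw [ENNReal.mul_rpow_of_nonneg _ _ hq0.le, ← ENNReal.rpow_mul, ← ENNReal.rpow_mul,
    one_div_mul_cancel hq0.ne', ENNReal.rpow_one]
  congr 2
  field_simp

/-! ### The analysis operator from `L^q([0,1])` to `ℓ^q` -/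

theorem lebesgueI_eq_restrict_Ioo : lebesgueI = volume.restrict (Ioo (0 : ℝ) 1) :=
  Measure.restrict_congr_set Ioo_ae_eq_Icc.symm

theorem ae_lebesgueI_mem_Ioo : ∀ᵐ t ∂lebesgueI, t ∈ Ioo (0 : ℝ) 1 := by
  rw [lebesgueI_eq_restrict_Ioo]
  exact ae_restrict_mem measurableSet_Ioo

/-- The kernel `t ^ (1/q - 1) c ψ(c log (1/t))` on `(0,1)`, where `ψ` is the peak kernel. -/
noncomputable def analysisKernel (M : ℕ) (q c t : ℝ) : ℝ :=
  t ^ (1 / q) * (t⁻¹ * (c * peakKernel M (c * -Real.log t)))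

theorem measurable_peakKernel_log (M : ℕ) (c : ℝ) :
    Measurable fun t => peakKernel M (c * -Real.log t) :=
  (continuous_peakKernel M).measurable.comp (by fun_prop)

theorem measurable_analysisKernel (M : ℕ) (q c : ℝ) : Measurable (analysisKernel M q c) := by
  have := measurable_peakKernel_log M c
  unfold analysisKernel
  fun_prop

theorem LacunaryWith.tsum_peakKernel_le {r : ℝ} (hr : 1 < r) {w : ℕ → ℝ} (hw : LacunaryWith r w)
    {M : ℕ} {K : ℝ} (hK : 0 ≤ K)
    (h : ∀ s, 0 ≤ s → |peakKernel M s| ≤ K * (s * Real.exp (-(2⁻¹ * s)))) {s : ℝ} (hs : 0 ≤ s) :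
    ∑' n, ENNReal.ofReal |peakKernel M (w n * s)| ≤
      ENNReal.ofReal (K * (16 * (r / (r - 1)))) := by
  rw [ENNReal.tsum_eq_iSup_nat]
  refine iSup_le fun N => ?_
  rw [← ENNReal.ofReal_sum_of_nonneg fun n _ => abs_nonneg _]
  refine ENNReal.ofReal_le_ofReal ?_
  have hx : ∀ n, 0 ≤ w n * s := fun n => mul_nonneg (hw.1 n).le hs
  calc ∑ n ∈ Finset.range N, |peakKernel M (w n * s)|
      ≤ ∑ n ∈ Finset.range N, K * (16 * (w n * s / (1 + w n * s) ^ 2)) :=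
        Finset.sum_le_sum fun n _ => (h _ (hx n)).trans
          (mul_le_mul_of_nonneg_left (mul_exp_neg_le (hx n)) hK)
    _ = K * (16 * ∑ n ∈ Finset.range N, w n * s / (1 + w n * s) ^ 2) := by
        rw [Finset.mul_sum, Finset.mul_sum]
    _ ≤ _ := by
        gcongr
        exact hw.sum_div_one_add_sq_le hr hs N

/-- Hölder with density `t⁻¹ * c * |ψ(c log (1/t))|`, of mass at most `4 * K`, applied to `|f| * t ^
(1/q)`: the `q`-th power of `t ^ (1/q)` cancels `t⁻¹`. The remaining factor `c` is what the
normalisation `w n ^ (-(1/q))` of the analysis operator removes. -/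
theorem lintegral_enorm_mul_analysisKernel_le {q : ℝ} (hq : 1 < q) {M : ℕ} {K : ℝ} (hK : 0 ≤ K)
    (h : ∀ s, 0 ≤ s → |peakKernel M s| ≤ K * (s * Real.exp (-(2⁻¹ * s)))) {c : ℝ} (hc : 0 < c)
    {f : ℝ → ℂ} (hf : AEStronglyMeasurable f lebesgueI) :
    (∫⁻ t, ‖f t * (analysisKernel M q c t : ℂ)‖ₑ ∂lebesgueI) ^ q ≤
      ENNReal.ofReal c * (∫⁻ t, ‖f t‖ₑ ^ q * ENNReal.ofReal |peakKernel M (c * -Real.log t)|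
        ∂lebesgueI) * ENNReal.ofReal (4 * K) ^ (q - 1) := by
  have hq0 : 0 < q := by linarith
  rw [lebesgueI_eq_restrict_Ioo] at hf ⊢
  have hm := measurable_peakKernel_log M c
  have hmk : Measurable fun t : ℝ =>
      ENNReal.ofReal (t⁻¹ * (c * |peakKernel M (c * -Real.log t)|)) := by fun_prop
  have e1 : ∫⁻ t in Ioo (0 : ℝ) 1, ‖f t * (analysisKernel M q c t : ℂ)‖ₑ =
      ∫⁻ t in Ioo (0 : ℝ) 1, (‖f t‖ₑ * ENNReal.ofReal (t ^ (1 / q))) *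
        ENNReal.ofReal (t⁻¹ * (c * |peakKernel M (c * -Real.log t)|)) := by
    refine setLIntegral_congr_fun measurableSet_Ioo fun t ht => ?_
    have ht0 := ht.1
    simp only [analysisKernel]
    rw [enorm_mul, mul_assoc, ← ENNReal.ofReal_mul (by positivity), ← ofReal_norm (_ : ℂ),
      ← ofReal_norm (_ : ℂ), Complex.norm_real, Real.norm_eq_abs, abs_mul, abs_mul, abs_mul,
      abs_of_pos hc, abs_of_pos (inv_pos.2 ht0), abs_of_pos (Real.rpow_pos_of_pos ht0 _)]
  have e2 : ∫⁻ t in Ioo (0 : ℝ) 1, (‖f t‖ₑ * ENNReal.ofReal (t ^ (1 / q))) ^ q *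
        ENNReal.ofReal (t⁻¹ * (c * |peakKernel M (c * -Real.log t)|)) =
      ∫⁻ t in Ioo (0 : ℝ) 1, ENNReal.ofReal c *
        (‖f t‖ₑ ^ q * ENNReal.ofReal |peakKernel M (c * -Real.log t)|) := by
    refine setLIntegral_congr_fun measurableSet_Ioo fun t ht => ?_
    have ht0 := ht.1
    rw [ENNReal.mul_rpow_of_nonneg _ _ hq0.le, ENNReal.ofReal_rpow_of_nonneg (by positivity) hq0.le,
      ← Real.rpow_mul ht0.le, one_div_mul_cancel hq0.ne', Real.rpow_one, mul_assoc,
      ← ENNReal.ofReal_mul ht0.le, mul_inv_cancel_left₀ ht0.ne', ENNReal.ofReal_mul hc.le]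
    ring
  rw [e1]
  refine (lintegral_mul_rpow_le _ hq
    (F := fun t => ‖f t‖ₑ * ENNReal.ofReal (t ^ (1 / q))) (hf.enorm.mul (by fun_prop)) hmk.aemeasurable).trans ?_
  rw [e2, lintegral_const_mul' _ _ ENNReal.ofReal_ne_top]
  exact mul_le_mul' le_rfl (ENNReal.rpow_le_rpow (lintegral_dilated_peakKernel_le hK h hc)
    (by linarith))

/-- Boundedness of the analysis operator from `L^q` to `ℓ^q`. -/
theorem exists_analysis {r q : ℝ} [Fact (1 ≤ ENNReal.ofReal q)] (hr : 1 < r) (hq : 1 < q)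
    {w : ℕ → ℝ} (hw : LacunaryWith r w) (M : ℕ) :
    ∃ A : LpC q lebesgueI →L[ℂ] SeqLp q, ∀ (f : LpC q lebesgueI) (n : ℕ),
      A f n = ((w n ^ (-(1 / q)) : ℝ) : ℂ) *
        ∫ t, f t * (analysisKernel M q (w n) t : ℂ) ∂lebesgueI := by
  have hq0 : 0 < q := by linarith
  obtain ⟨K, hK, h⟩ := exists_abs_peakKernel_le M
  set C₀ : ℝ≥0∞ := ENNReal.ofReal (4 * K) ^ (q - 1) with hC₀
  have hC₀t : C₀ ≠ ∞ := ENNReal.rpow_ne_top_of_nonneg (by linarith) ENNReal.ofReal_ne_top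
  set C₁ : ℝ≥0∞ := ENNReal.ofReal (K * (16 * (r / (r - 1)))) with hC₁
  have hC₁t : C₁ ≠ ∞ := ENNReal.ofReal_ne_top
  set a : LpC q lebesgueI → ℕ → ℝ≥0∞ := fun f n =>
    ∫⁻ t, ‖f t‖ₑ ^ q * ENNReal.ofReal |peakKernel M (w n * -Real.log t)| ∂lebesgueI with ha
  -- Summing under the integral leaves `∑ |ψ(w n * s)|`, bounded uniformly in `s` by lacunarity.
  have hsum : ∀ f, ∑' n, a f n ≤ C₁ * ‖f‖ₑ ^ q := fun f => by
    have hmeas : ∀ n, AEMeasurable (fun t => ‖f t‖ₑ ^ q *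
        ENNReal.ofReal |peakKernel M (w n * -Real.log t)|) lebesgueI := fun n => by
      have h1 := measurable_peakKernel_log M (w n)
      have h2 : Measurable fun t =>
          ENNReal.ofReal |peakKernel M (w n * -Real.log t)| := by fun_prop
      exact ((Lp.aestronglyMeasurable f).enorm.pow_const q).mul h2.aemeasurable
    rw [ha, ← lintegral_tsum hmeas, enorm_rpow_lp hq0,
      ← lintegral_const_mul'' _ ((Lp.aestronglyMeasurable f).enorm.pow_const q)]
    refine lintegral_mono_ae ?_
    filter_upwards [ae_lebesgueI_mem_Ioo] with t ht
    rw [ENNReal.tsum_mul_left, mul_comm]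
    gcongr
    exact hw.tsum_peakKernel_le hr hK h (neg_nonneg.2 (Real.log_nonpos ht.1.le ht.2.le))
  have hat : ∀ f n, a f n ≠ ∞ := fun f n => by
    refine ne_top_of_le_ne_top ?_ ((ENNReal.le_tsum n).trans (hsum f))
    have : ‖f‖ₑ ^ q ≠ ∞ := ENNReal.rpow_ne_top_of_nonneg hq0.le enorm_ne_top
    finiteness
  have hkey : ∀ f n, (∫⁻ t, ‖f t * (analysisKernel M q (w n) t : ℂ)‖ₑ ∂lebesgueI) ^ q ≤
      ENNReal.ofReal (w n) * a f n * C₀ := fun f n =>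
    lintegral_enorm_mul_analysisKernel_le hq hK h (hw.1 n) (Lp.aestronglyMeasurable f)
  have hint : ∀ (f : LpC q lebesgueI) (n : ℕ),
      Integrable (fun t => f t * (analysisKernel M q (w n) t : ℂ)) lebesgueI := fun f n => by
    refine ⟨(Lp.aestronglyMeasurable f).mul (Complex.measurable_ofReal.comp
      (measurable_analysisKernel M q (w n))).aestronglyMeasurable, ?_⟩
    have h1 := hat f n
    have h2 : (∫⁻ t, ‖f t * (analysisKernel M q (w n) t : ℂ)‖ₑ ∂lebesgueI) ^ q < ∞ :=
      (hkey f n).trans_lt (by finiteness)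
    rwa [ENNReal.rpow_lt_top_iff_of_pos hq0] at h2
  set B : LpC q lebesgueI → ℕ → ℂ := fun f n => ((w n ^ (-(1 / q)) : ℝ) : ℂ) *
        ∫ t, f t * (analysisKernel M q (w n) t : ℂ) ∂lebesgueI with hB
  have hBn : ∀ f n, ‖B f n‖ₑ ^ q ≤ a f n * C₀ := fun f n => by
    have hwn := hw.1 n
    have e : ‖((w n ^ (-(1 / q)) : ℝ) : ℂ)‖ₑ ^ q = ENNReal.ofReal (w n)⁻¹ := by
      rw [← ofReal_norm, Complex.norm_real, Real.norm_of_nonneg (by positivity),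
        ENNReal.ofReal_rpow_of_nonneg (by positivity) hq0.le, ← Real.rpow_mul hwn.le, neg_mul,
        one_div_mul_cancel hq0.ne', Real.rpow_neg_one]
    rw [hB, enorm_mul, ENNReal.mul_rpow_of_nonneg _ _ hq0.le, e]
    calc _ ≤ ENNReal.ofReal (w n)⁻¹ * (ENNReal.ofReal (w n) * a f n * C₀) := by
          gcongr
          exact (ENNReal.rpow_le_rpow (enorm_integral_le_lintegral_enorm _) hq0.le).trans (hkey f n)
      _ = ENNReal.ofReal ((w n)⁻¹ * w n) * (a f n * C₀) := by
          rw [ENNReal.ofReal_mul (by positivity)]; ring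
      _ = _ := by rw [inv_mul_cancel₀ hwn.ne', ENNReal.ofReal_one, one_mul]
  have hBs : ∀ f, ∑' n, ‖B f n‖ₑ ^ q ≤ (C₁ * C₀).toNNReal * ‖f‖ₑ ^ q := fun f => by
    rw [ENNReal.coe_toNNReal (by finiteness)]
    calc _ ≤ ∑' n, a f n * C₀ := ENNReal.tsum_le_tsum (hBn f)
      _ = (∑' n, a f n) * C₀ := ENNReal.tsum_mul_right
      _ ≤ C₁ * ‖f‖ₑ ^ q * C₀ := by gcongr; exact hsum f
      _ = _ := by ring
  have hmem : ∀ f, Memℓp (B f) (ENNReal.ofReal q) := fun f =>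
    memℓp_of_tsum_enorm_rpow_ne_top hq0 (ne_top_of_le_ne_top
      (ENNReal.mul_ne_top ENNReal.coe_ne_top
        (ENNReal.rpow_ne_top_of_nonneg hq0.le enorm_ne_top)) (hBs f))
  let A : LpC q lebesgueI →ₗ[ℂ] SeqLp q :=
    { toFun := fun f => ⟨B f, hmem f⟩
      map_add' := fun f g => by
        ext n
        change B (f + g) n = B f n + B g n
        simp only [hB]
        rw [← mul_add, ← integral_add (hint f n) (hint g n)]
        congr 1
        refine integral_congr_ae ?_
        filter_upwards [Lp.coeFn_add f g] with t ht
        rw [ht, Pi.add_apply, add_mul]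
      map_smul' := fun c f => by
        ext n
        change B (c • f) n = c * B f n
        simp only [hB]
        rw [mul_left_comm, ← integral_const_mul c]
        congr 1
        refine integral_congr_ae ?_
        filter_upwards [Lp.coeFn_smul c f] with t ht
        rw [ht, Pi.smul_apply, smul_eq_mul, mul_assoc] }
  refine ⟨A.mkContinuous ((C₁ * C₀).toNNReal ^ (1 / q) : ℝ≥0) fun f => ?_, fun f n => rfl⟩
  refine norm_le_of_enorm_rpow_le hq0 ?_
  rw [enorm_rpow_seqLp hq0]
  exact hBs f

/-! ### The matrix of analysis after synthesis, and its invertibility -/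

/-- The factor `t ^ (1/q)` of the kernel turns `t ^ lam` into `exp (-(lam + 1/q) * s)`, which is why
the weights are `Λ n + 1/q`: the peak then falls exactly on the diagonal. -/
theorem integral_rpow_mul_analysisKernel (M : ℕ) {q lam c : ℝ} (hlam : 0 < lam + 1 / q)
    (hc : 0 < c) :
    ∫ t, t ^ lam * analysisKernel M q c t ∂lebesgueI =
      (4 * (lam + 1 / q) * c / ((lam + 1 / q) + c) ^ 2) ^ (M + 2) := by
  rw [← integral_exp_mul_peakKernel M hlam hc, ← integral_Ioo_comp_neg_log,
    lebesgueI_eq_restrict_Ioo]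
  refine setIntegral_congr_fun measurableSet_Ioo fun t ht => ?_
  have ht0 := ht.1
  simp only [analysisKernel]
  rw [← mul_assoc, ← Real.rpow_add ht0, Real.rpow_def_of_pos ht0,
    show -((lam + 1 / q) * -Real.log t) = Real.log t * (lam + 1 / q) by ring]
  ring

/-- Almost-diagonality of the matrix `(w_k / w_n)^(1/q) (4 w_n w_k / (w_n + w_k)^2)^(M+2)`. -/
theorem LacunaryWith.matrix_le {r : ℝ} (hr : 1 < r) {w : ℕ → ℝ} (hw : LacunaryWith r w)
    {q : ℝ} (hq : 1 < q) (M : ℕ) {n k : ℕ} (hnk : n ≠ k) :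
    (w k / w n) ^ (1 / q) * (4 * w k * w n / (w k + w n) ^ 2) ^ (M + 2) ≤
      16 * (4 * r / (1 + r) ^ 2) ^ M * r⁻¹ ^ (n - k + (k - n)) := by
  have hr0 : 0 < r := by linarith
  -- Of the `M + 2` factors, `M` give the small constant and two give `16 * (a / b) ^ 2`, one power
  -- of which cancels `b / a`, the worst case of `(w k / w n) ^ (1/q)`.
  have key : ∀ a b : ℝ, 0 < a → 0 < b → ∀ d : ℕ, 0 < d → a / b ≤ r⁻¹ ^ d →
      b / a * (4 * a * b / (a + b) ^ 2) ^ (M + 2) ≤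
        16 * (4 * r / (1 + r) ^ 2) ^ M * r⁻¹ ^ d := by
    intro a b ha hb d hd hab
    have h0 : r⁻¹ ^ d ≤ r⁻¹ :=
      pow_le_of_le_one (by positivity) (inv_le_one_of_one_le₀ hr.le) hd.ne'
    have h1 : r * a ≤ b := by
      have := hab.trans h0
      rw [div_le_iff₀ hb, inv_mul_eq_div, le_div_iff₀ hr0] at this
      linarith
    have h2 : 4 * a * b / (a + b) ^ 2 ≤ 4 * r / (1 + r) ^ 2 := by
      rw [div_le_div_iff₀ (by positivity) (by positivity)]
      have : 0 ≤ (b - r * a) * (r * b - a) := mul_nonneg (by linarith) (by nlinarith)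
      nlinarith
    have h3 : 4 * a * b / (a + b) ^ 2 ≤ 4 * (a / b) := by
      rw [mul_div_assoc', div_le_div_iff₀ (by positivity) hb]
      have : 0 ≤ a * (a * a + 2 * a * b) := by positivity
      nlinarith
    calc b / a * (4 * a * b / (a + b) ^ 2) ^ (M + 2)
        = b / a * ((4 * a * b / (a + b) ^ 2) ^ M * (4 * a * b / (a + b) ^ 2) ^ 2) := by ring
      _ ≤ b / a * ((4 * r / (1 + r) ^ 2) ^ M * (4 * (a / b)) ^ 2) := by gcongr
      _ = 16 * (4 * r / (1 + r) ^ 2) ^ M * (a / b) := by field_simp; ring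
      _ ≤ _ := by gcongr
  have hn := hw.1 n
  have hk := hw.1 k
  have hq1 : 1 / q ≤ 1 := by rw [div_le_one (by linarith)]; exact hq.le
  rcases lt_or_gt_of_ne hnk with h | h
  · rw [Nat.sub_eq_zero_of_le h.le, zero_add]
    have h1 : w n / w k ≤ r⁻¹ ^ (k - n) := hw.div_le hr h.le
    have h2 : 1 ≤ w k / w n := by
      have h3 : w n / w k ≤ 1 := h1.trans
        (pow_le_one₀ (by positivity) (inv_le_one_of_one_le₀ hr.le))
      rw [div_le_one hk] at h3
      rwa [one_le_div hn]
    refine le_trans ?_ (key (w n) (w k) hn hk (k - n) (by omega) h1)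
    rw [show 4 * w k * w n = 4 * w n * w k by ring, add_comm (w k)]
    refine mul_le_mul_of_nonneg_right ?_ (by positivity)
    calc (w k / w n) ^ (1 / q) ≤ (w k / w n) ^ (1 : ℝ) :=
          Real.rpow_le_rpow_of_exponent_le h2 hq1
      _ = _ := Real.rpow_one _
  · rw [Nat.sub_eq_zero_of_le h.le, add_zero]
    have h1 : w k / w n ≤ r⁻¹ ^ (n - k) := hw.div_le hr h.le
    have h2 : w k / w n ≤ 1 := h1.trans
        (pow_le_one₀ (by positivity) (inv_le_one_of_one_le₀ hr.le))
    refine le_trans ?_ (key (w k) (w n) hk hn (n - k) (by omega) h1)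
    refine mul_le_mul_of_nonneg_right ?_ (by positivity)
    calc (w k / w n) ^ (1 / q) ≤ 1 := Real.rpow_le_one (by positivity) h2 (by positivity)
      _ ≤ w n / w k := by
        rw [one_le_div hk]; rwa [div_le_one hn] at h2

/-- An operator on `ℓ^q` whose matrix is close to the identity is invertible. -/
theorem isUnit_of_matrix_close {q : ℝ} [Fact (1 ≤ ENNReal.ofReal q)] (hq : 1 < q) {x e : ℝ≥0∞}
    (he : e * (2 * (1 - x)⁻¹) ≤ 2⁻¹) (G : SeqLp q →L[ℂ] SeqLp q)
    (hdiag : ∀ n, G (lp.single (ENNReal.ofReal q) n 1) n = 1)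
    (hoff : ∀ n k, n ≠ k → ‖G (lp.single (ENNReal.ofReal q) k 1) n‖ₑ ≤ e * x ^ (n - k + (k - n))) :
    IsUnit G := by
  have hq0 : 0 < q := by linarith
  set S : ℝ≥0∞ := e * (2 * (1 - x)⁻¹) with hS
  have hcol : ∀ n, ∑' k, e * x ^ (n - k + (k - n)) ≤ S := fun n => by
    rw [ENNReal.tsum_mul_left]
    exact mul_le_mul' le_rfl (tsum_pow_dist_le x n)
  have hcoord : ∀ (b : SeqLp q) (n : ℕ),
      HasSum (fun k => b k * (G (lp.single (ENNReal.ofReal q) k 1) n - if k = n then 1 else 0))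
        ((G b - b) n) := fun b n => by
    have h1 := (lp.hasSum_single (p := ENNReal.ofReal q) ENNReal.ofReal_ne_top b).mapL
      ((lp.evalCLM ℂ (fun _ : ℕ => ℂ) (ENNReal.ofReal q) n).comp
        (G - ContinuousLinearMap.id ℂ (SeqLp q)))
    refine (h1.congr_fun fun k => ?_)
    have h2 : (lp.single (ENNReal.ofReal q) k (b k) : SeqLp q) =
        b k • (lp.single (ENNReal.ofReal q) k (1 : ℂ) : SeqLp q) := by
      rw [← lp.single_smul, smul_eq_mul, mul_one]
    rw [h2, map_smul, smul_eq_mul]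
    congr 1
    change _ = G (lp.single (ENNReal.ofReal q) k 1) n -
      (lp.single (ENNReal.ofReal q) k (1 : ℂ) : SeqLp q) n
    rw [lp.single_apply]
    congr 1
    by_cases hkn : k = n
    · subst hkn; simp
    · simp [hkn, Ne.symm hkn]
  have hn : ∀ (b : SeqLp q) (n : ℕ), ‖(G b - b) n‖ₑ ≤ ∑' k, ‖b k‖ₑ * (e * x ^ (n - k + (k - n))) :=
    fun b n => by
      rw [← (hcoord b n).tsum_eq]
      refine enorm_tsum_le_tsum_enorm.trans (ENNReal.tsum_le_tsum fun k => ?_)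
      rw [enorm_mul]
      gcongr
      by_cases hkn : k = n
      · subst hkn; simp [hdiag]
      · simpa [hkn] using hoff n k (Ne.symm hkn)
  have hb : ∀ b : SeqLp q, ‖(1 - G) b‖ ≤ 2⁻¹ * ‖b‖ := fun b => by
    have h1 : ‖(1 - G) b‖ₑ ^ q ≤ (((2 : ℝ≥0)⁻¹ ^ q : ℝ≥0) : ℝ≥0∞) * ‖b‖ₑ ^ q := by
      have hneg : (1 - G) b = -(G b - b) := by
        rw [neg_sub]; rfl
      rw [hneg, enorm_neg, enorm_rpow_seqLp hq0, enorm_rpow_seqLp hq0]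
      -- Schur test: the row sums contribute `S ^ (q - 1)` and the column sums, equal by symmetry,
      -- contribute `S`.
      calc ∑' n, ‖(G b - b) n‖ₑ ^ q
          ≤ ∑' n, (∑' k, ‖b k‖ₑ ^ q * (e * x ^ (n - k + (k - n)))) * S ^ (q - 1) := by
            refine ENNReal.tsum_le_tsum fun n => ?_
            refine (ENNReal.rpow_le_rpow (hn b n) hq0.le).trans ?_
            have h3 := lintegral_mul_rpow_le (Measure.count : Measure ℕ) hq
              (F := fun k => ‖b k‖ₑ) (k := fun k => e * x ^ (n - k + (k - n)))
              (Measurable.of_discrete).aemeasurable (Measurable.of_discrete).aemeasurable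
            simp only [lintegral_count] at h3
            refine h3.trans ?_
            exact mul_le_mul' le_rfl (ENNReal.rpow_le_rpow (hcol n) (by linarith))
        _ = (∑' k, ‖b k‖ₑ ^ q * ∑' n, e * x ^ (n - k + (k - n))) * S ^ (q - 1) := by
            rw [ENNReal.tsum_mul_right, ENNReal.tsum_comm]
            simp_rw [ENNReal.tsum_mul_left]
        _ ≤ (∑' k, ‖b k‖ₑ ^ q * S) * S ^ (q - 1) := by
            gcongr with k
            refine le_trans (le_of_eq (tsum_congr fun n => ?_)) (hcol k)
            rw [add_comm]
        _ = S ^ q * ∑' k, ‖b k‖ₑ ^ q := by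
            rw [ENNReal.tsum_mul_right]
            have : S ^ q = S ^ (1 : ℝ) * S ^ (q - 1) := by
              rw [← ENNReal.rpow_add_of_nonneg _ _ zero_le_one (by linarith)]; congr 1; ring
            rw [this, ENNReal.rpow_one]; ring
        _ ≤ _ := by
            gcongr
            rw [ENNReal.coe_rpow_of_nonneg _ hq0.le]
            refine ENNReal.rpow_le_rpow (he.trans (le_of_eq ?_)) hq0.le
            rw [ENNReal.coe_inv two_ne_zero]; rfl
    have h2 := norm_le_of_enorm_rpow_le hq0 h1
    rwa [← NNReal.rpow_mul, mul_one_div_cancel hq0.ne', NNReal.rpow_one] at h2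
  -- Neumann series: `G` is within distance 1/2 of the identity.
  have hlt : ‖1 - G‖ < 1 :=
    (ContinuousLinearMap.opNorm_le_bound _ (by norm_num) hb).trans_lt (by norm_num)
  have := (Units.oneSub (1 - G) hlt).isUnit
  rwa [Units.val_oneSub, sub_sub_cancel] at this

/-! ### Shifted exponents, pointwise convergence and test integrals -/

theorem LacunaryWith.le_apply {r : ℝ} (hr : 1 < r) {w : ℕ → ℝ} (hw : LacunaryWith r w) (n : ℕ) :
    w 0 ≤ w n := by
  have := hw.le_pow_mul hr 0 n
  rw [zero_add] at this
  exact this.trans (mul_le_of_le_one_left (hw.1 n).le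
    (pow_le_one₀ (by positivity) (inv_le_one_of_one_le₀ hr.le)))

/-- The ratio `(r * x + c) / (x + c)` increases with `x`, so its least value along the sequence is
taken at `w 0`, where it exceeds 1. -/
theorem LacunaryWith.exists_add_const {r : ℝ} (hr : 1 < r) {w : ℕ → ℝ} (hw : LacunaryWith r w)
    {c : ℝ} (hc : 0 < c) : ∃ r' : ℝ, 1 < r' ∧ LacunaryWith r' fun n => w n + c := by
  have h0 := hw.1 0
  refine ⟨(r * w 0 + c) / (w 0 + c), ?_, fun n => add_pos (hw.1 n) hc, fun n => ?_⟩
  · rw [one_lt_div (by positivity)]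
    nlinarith
  · have h1 := hw.le_apply hr n
    have h2 := hw.2 n
    rw [div_mul_eq_mul_div, div_le_iff₀ (by positivity)]
    have h3 : 0 ≤ (r - 1) * c * (w n - w 0) :=
      mul_nonneg (mul_nonneg (by linarith) hc.le) (by linarith)
    have h4 : (r * w n + c) * (w 0 + c) ≤ (w (n + 1) + c) * (w 0 + c) := by gcongr
    nlinarith

/-- For fixed `t` in `(0,1)` the weight is at most a multiple of `lam n`, and the exponential decay
in `lam n * log (1/t)` reduces the series to the telescoping one. -/
theorem LacunaryWith.summable_mul_rpow {r : ℝ} (hr : 1 < r) {lam : ℕ → ℝ}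
    (hl : LacunaryWith r lam) {c q : ℝ} (hc : 0 < c) (hq : 1 < q) {t : ℝ}
    (ht : t ∈ Ico (0 : ℝ) 1) : Summable fun n => (lam n + c) ^ (1 / q) * t ^ lam n := by
  have hq0 : 0 < q := by linarith
  rcases ht.1.eq_or_lt with h0 | h0
  · refine summable_zero.congr fun n => ?_
    rw [← h0, Real.zero_rpow (hl.1 n).ne', mul_zero]
  have hs : 0 < -Real.log t := neg_pos.2 (Real.log_neg h0 ht.2)
  set s := -Real.log t with hsdef
  have hx : ∀ n, 0 < lam n * s := fun n => mul_pos (hl.1 n) hs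
  have hsum : Summable fun n => lam n * s / (1 + lam n * s) ^ 2 :=
    summable_of_sum_range_le (fun n => by have := hx n; positivity)
      (hl.sum_div_one_add_sq_le hr hs.le)
  have hl0 := hl.1 0
  refine Summable.of_nonneg_of_le (fun n => ?_) (fun n => ?_)
    (hsum.mul_left (((1 + c) / lam 0 + 1) / s * 16))
  · have := hl.1 n
    positivity
  have hln := hl.1 n
  have h1 : (lam n + c) ^ (1 / q) ≤ 1 + (lam n + c) := by
    rcases le_total (lam n + c) 1 with h | h
    · exact (Real.rpow_le_one (by positivity) h (by positivity)).trans (by linarith)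
    · refine (Real.rpow_le_rpow_of_exponent_le h (y := 1 / q) (z := 1) ?_).trans ?_
      · rw [div_le_one hq0]; exact hq.le
      · rw [Real.rpow_one]; linarith
  have h2 : 1 + (lam n + c) ≤ ((1 + c) / lam 0 + 1) * lam n := by
    have := hl.le_apply hr n
    have h3 : 1 + c ≤ (1 + c) / lam 0 * lam n := by
      rw [div_mul_eq_mul_div, le_div_iff₀ hl0]; gcongr
    linarith
  have h3 : t ^ lam n ≤ Real.exp (-(2⁻¹ * (lam n * s))) := by
    rw [Real.rpow_def_of_pos h0, show Real.log t = -s by rw [hsdef, neg_neg]]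
    refine Real.exp_le_exp.2 ?_
    have := hx n
    nlinarith
  calc (lam n + c) ^ (1 / q) * t ^ lam n
      ≤ (((1 + c) / lam 0 + 1) * lam n) * Real.exp (-(2⁻¹ * (lam n * s))) :=
        mul_le_mul (h1.trans h2) h3 (by positivity) (by positivity)
    _ = ((1 + c) / lam 0 + 1) / s * (lam n * s * Real.exp (-(2⁻¹ * (lam n * s)))) := by
        field_simp
    _ ≤ ((1 + c) / lam 0 + 1) / s * (16 * (lam n * s / (1 + lam n * s) ^ 2)) :=
        mul_le_mul_of_nonneg_left (mul_exp_neg_le (hx n).le) (by positivity)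
    _ = _ := by ring

theorem lintegral_ofReal_mul_rpow_lebesgueI_le {lam w : ℝ} (hlam : 0 < lam) (hw : w ≤ lam + 1) :
    ∫⁻ t, ENNReal.ofReal (w * (t ^ lam) ^ (1 : ℝ)) ∂lebesgueI ≤ 1 := by
  have hI : ∫ t in Ioo (0 : ℝ) 1, t ^ lam = 1 / (lam + 1) := by
    rw [← integral_Ioc_eq_integral_Ioo, ← intervalIntegral.integral_of_le zero_le_one,
      integral_rpow (Or.inl (by linarith)), Real.one_rpow, Real.zero_rpow (by linarith), sub_zero]
  have hint : IntegrableOn (fun t : ℝ => t ^ lam) (Ioo 0 1) := by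
    -- A non-integrable function would have Bochner integral 0, but the computed value is positive.
    by_contra h
    rw [integral_undef h] at hI
    have : 0 < 1 / (lam + 1) := by positivity
    linarith
  calc ∫⁻ t, ENNReal.ofReal (w * (t ^ lam) ^ (1 : ℝ)) ∂lebesgueI
      ≤ ∫⁻ t, ENNReal.ofReal (lam + 1) * ENNReal.ofReal (t ^ lam) ∂lebesgueI := by
        refine lintegral_mono_ae ?_
        filter_upwards [ae_lebesgueI_mem_Ioo] with t ht
        have := Real.rpow_nonneg ht.1.le lam
        rw [Real.rpow_one, ← ENNReal.ofReal_mul (by linarith)]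
        gcongr
    _ = ENNReal.ofReal (lam + 1) * ENNReal.ofReal (1 / (lam + 1)) := by
        rw [lintegral_const_mul' _ _ ENNReal.ofReal_ne_top, ← hI, lebesgueI_eq_restrict_Ioo,
          ofReal_integral_eq_lintegral_ofReal hint
            ((ae_restrict_mem measurableSet_Ioo).mono fun t ht => Real.rpow_nonneg ht.1.le lam)]
    _ ≤ 1 := by
        rw [← ENNReal.ofReal_mul (by linarith), mul_one_div_cancel (by linarith),
          ENNReal.ofReal_one]

/-- Adding `c` to the weight costs only the factor `1 + c / Λ 0`, because `Λ n ≥ Λ 0`. -/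
theorem tendsto_lintegral_of_conditionSmallB {r : ℝ} (hr : 1 < r) {Λ : ℕ → ℝ}
    (hΛ : LacunaryWith r Λ) {μ : Measure ℝ} [IsFiniteMeasure μ] (hμ : μ (Ico (0 : ℝ) 1)ᶜ = 0)
    {p : ℝ} (hp : 0 < p) (hb : ConditionSmallB Λ p μ) {c : ℝ} (hc : 0 < c) :
    Tendsto (fun n => ∫⁻ t, ENNReal.ofReal ((Λ n + c) * (t ^ Λ n) ^ p) ∂μ) atTop (𝓝 0) := by
  have h0 := hΛ.1 0
  have hae : ∀ᵐ t ∂μ, t ∈ Ico (0 : ℝ) 1 := hμ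
  have hres : μ.restrict (Ico (0 : ℝ) 1) = μ := Measure.restrict_eq_self_of_ae_mem hae
  have hlim : Tendsto (fun n => ENNReal.ofReal ((1 + c / Λ 0) *
      (Λ n * ∫ t in Ico (0 : ℝ) 1, t ^ (p * Λ n) ∂μ))) atTop (𝓝 0) := by
    have := ENNReal.tendsto_ofReal (hb.const_mul (1 + c / Λ 0))
    rwa [mul_zero, ENNReal.ofReal_zero] at this
  refine tendsto_of_tendsto_of_tendsto_of_le_of_le tendsto_const_nhds hlim
    (fun n => zero_le) fun n => ?_
  have hn := hΛ.1 n
  have hint : Integrable (fun t : ℝ => t ^ (p * Λ n)) μ := by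
    refine Integrable.of_bound (C := 1) ?_ ?_
    · exact Measurable.aestronglyMeasurable (by fun_prop)
    · filter_upwards [hae] with t ht
      rw [Real.norm_of_nonneg (Real.rpow_nonneg ht.1 _)]
      exact Real.rpow_le_one ht.1 ht.2.le (by positivity)
  have hcoef : Λ n + c ≤ (1 + c / Λ 0) * Λ n := by
    have h1 : c ≤ c / Λ 0 * Λ n := by
      rw [div_mul_eq_mul_div, le_div_iff₀ h0]
      exact mul_le_mul_of_nonneg_left (hΛ.le_apply hr n) hc.le
    linarith
  simp only
  rw [hres, ← mul_assoc, ENNReal.ofReal_mul (by positivity),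
    ofReal_integral_eq_lintegral_ofReal hint
      (hae.mono fun t ht => Real.rpow_nonneg ht.1 _),
    ← lintegral_const_mul' _ _ ENNReal.ofReal_ne_top]
  refine lintegral_mono_ae ?_
  filter_upwards [hae] with t ht
  have := Real.rpow_nonneg ht.1 (p * Λ n)
  rw [← Real.rpow_mul ht.1, mul_comm (Λ n) p, ← ENNReal.ofReal_mul (by positivity)]
  gcongr

/-! ### The left inverse of synthesis on `L^q([0,1])` -/

theorem exists_pow_bound {r : ℝ} (hr : 1 < r) : ∃ M : ℕ,
    ENNReal.ofReal (16 * (4 * r / (1 + r) ^ 2) ^ M) * (2 * (1 - ENNReal.ofReal r⁻¹)⁻¹) ≤ 2⁻¹ := by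
  have hr0 : 0 < r := by linarith
  have h1 : 0 < 1 - r⁻¹ := sub_pos.2 (inv_lt_one_of_one_lt₀ hr)
  have hu : 4 * r / (1 + r) ^ 2 < 1 := by
    rw [div_lt_one (by positivity)]
    nlinarith [sq_pos_of_pos (sub_pos.2 hr)]
  -- The number 64 makes `16 / 64 * 2` equal to the required `1/2`.
  obtain ⟨M, hM⟩ := exists_pow_lt_of_lt_one (show 0 < (1 - r⁻¹) / 64 by positivity) hu
  refine ⟨M, ?_⟩
  have e1 : (1 - ENNReal.ofReal r⁻¹)⁻¹ = ENNReal.ofReal (1 - r⁻¹)⁻¹ := by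
    rw [ENNReal.ofReal_inv_of_pos h1, ENNReal.ofReal_sub _ (by positivity), ENNReal.ofReal_one]
  have e2 : (2 : ℝ≥0∞)⁻¹ = ENNReal.ofReal 2⁻¹ := by
    rw [ENNReal.ofReal_inv_of_pos two_pos, ENNReal.ofReal_ofNat]
  rw [e1, e2, ← ENNReal.ofReal_ofNat 2, ← ENNReal.ofReal_mul (by norm_num),
    ← ENNReal.ofReal_mul (by positivity)]
  refine ENNReal.ofReal_le_ofReal ?_
  calc 16 * (4 * r / (1 + r) ^ 2) ^ M * (2 * (1 - r⁻¹)⁻¹)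
      ≤ 16 * ((1 - r⁻¹) / 64) * (2 * (1 - r⁻¹)⁻¹) := by gcongr
    _ = 2⁻¹ := by
      generalize 1 - r⁻¹ = y at h1
      field_simp
      norm_num

/-- The synthesis operator of the normalized Müntz system on `L^q([0,1])` has a bounded left
inverse. -/
theorem exists_leftInverse_synthesis {r q : ℝ} [Fact (1 ≤ ENNReal.ofReal q)] (hq : 1 < q)
    {Λ : ℕ → ℝ} (hr : 1 < r) (hw : LacunaryWith r fun n => Λ n + 1 / q)
    {T : SeqLp q →L[ℂ] LpC q lebesgueI} (hT : ∀ k,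
      T (lp.single (ENNReal.ofReal q) k 1) =ᵐ[lebesgueI]
        fun t => (((Λ k + 1 / q) ^ (1 / q) * t ^ Λ k : ℝ) : ℂ)) :
    ∃ B : LpC q lebesgueI →L[ℂ] SeqLp q, ∀ b, B (T b) = b := by
  have hq0 : 0 < q := by linarith
  obtain ⟨M, hM⟩ := exists_pow_bound hr
  obtain ⟨A, hA⟩ := exists_analysis hr hq hw M
  have hpos : ∀ n, 0 < Λ n + 1 / q := hw.1
  have hentry : ∀ n k, (A.comp T) (lp.single (ENNReal.ofReal q) k 1) n =
      ((((Λ k + 1 / q) / (Λ n + 1 / q)) ^ (1 / q) * (4 * (Λ k + 1 / q) * (Λ n + 1 / q) /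
        ((Λ k + 1 / q) + (Λ n + 1 / q)) ^ 2) ^ (M + 2) : ℝ) : ℂ) := fun n k => by
    rw [ContinuousLinearMap.comp_apply, hA]
    have h1 : ∫ t, T (lp.single (ENNReal.ofReal q) k 1) t *
          (analysisKernel M q (Λ n + 1 / q) t : ℂ) ∂lebesgueI =
        ∫ t, (((Λ k + 1 / q) ^ (1 / q) * (t ^ Λ k *
          analysisKernel M q (Λ n + 1 / q) t) : ℝ) : ℂ) ∂lebesgueI := by
      refine integral_congr_ae ?_
      filter_upwards [hT k] with t ht
      rw [ht, ← Complex.ofReal_mul, mul_assoc]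
    rw [h1, integral_complex_ofReal, integral_const_mul,
      integral_rpow_mul_analysisKernel M (hpos k) (hpos n), ← Complex.ofReal_mul,
      Real.div_rpow (hpos k).le (hpos n).le, Real.rpow_neg (hpos n).le]
    congr 1
    ring
  have hunit : IsUnit (A.comp T) := by
    refine isUnit_of_matrix_close hq hM (A.comp T) (fun n => ?_) (fun n k hnk => ?_)
    · have := hpos n
      rw [hentry, div_self this.ne', Real.one_rpow, one_mul, ← two_mul, mul_pow]
      have h2 : 4 * (Λ n + 1 / q) * (Λ n + 1 / q) / (2 ^ 2 * (Λ n + 1 / q) ^ 2) = 1 := by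
        generalize Λ n + 1 / q = y at this
        field_simp
        norm_num
      rw [h2, one_pow, Complex.ofReal_one]
    · have := hpos n
      have := hpos k
      have := hr
      rw [hentry, ← ofReal_norm, Complex.norm_real, Real.norm_of_nonneg (by positivity),
        ← ENNReal.ofReal_pow (by positivity), ← ENNReal.ofReal_mul (by positivity)]
      exact ENNReal.ofReal_le_ofReal (hw.matrix_le hr hq M hnk)
  obtain ⟨U, hU⟩ := hunit
  refine ⟨(↑U⁻¹ : SeqLp q →L[ℂ] SeqLp q).comp A, fun b => ?_⟩
  have h1 : (↑U⁻¹ : SeqLp q →L[ℂ] SeqLp q) * A.comp T = 1 := by rw [← hU]; exact U.inv_mul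
  exact congrArg (fun L : SeqLp q →L[ℂ] SeqLp q => L b) h1

theorem tsum_single_mul {q : ℝ} (k : ℕ) (u : ℕ → ℂ) :
    ∑' n, (lp.single (E := fun _ : ℕ => ℂ) (ENNReal.ofReal q) k 1 : SeqLp q) n * u n = u k := by
  rw [tsum_eq_single k fun n hn => by rw [lp.single_apply, Pi.single_eq_of_ne hn, zero_mul],
    lp.single_apply, Pi.single_eq_same, one_mul]

/-- `T` after `B` fixes every `T b`, hence each monomial, which is a multiple of some `T e_n`; its
fixed points form a closed subspace, so they contain the closed span. -/
theorem synthesis_leftInverse_eq_of_mem_muntzSpace {q : ℝ} [Fact (1 ≤ ENNReal.ofReal q)]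
    {Λ c : ℕ → ℝ} (hc : ∀ n, c n ≠ 0) {T : SeqLp q →L[ℂ] LpC q lebesgueI}
    (hT : ∀ k, T (lp.single (ENNReal.ofReal q) k 1) =ᵐ[lebesgueI]
      fun t => ((c k * t ^ Λ k : ℝ) : ℂ))
    {B : LpC q lebesgueI →L[ℂ] SeqLp q} (hB : ∀ b, B (T b) = b)
    {f : LpC q lebesgueI} (hf : f ∈ muntzSpace Λ q) : T (B f) = f := by
  let V : Submodule ℂ (LpC q lebesgueI) :=
    LinearMap.ker (T.comp B - ContinuousLinearMap.id ℂ (LpC q lebesgueI)).toLinearMap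
  have hV : IsClosed (V : Set (LpC q lebesgueI)) :=
    (T.comp B - ContinuousLinearMap.id ℂ (LpC q lebesgueI)).isClosed_ker
  have hmem : f ∈ V := by
    refine Submodule.topologicalClosure_minimal _ (Submodule.span_le.2 ?_) hV hf
    rintro g ⟨n, hg⟩
    have hgT : g = T (((c n)⁻¹ : ℂ) • lp.single (ENNReal.ofReal q) n 1) := by
      rw [map_smul]
      refine Lp.ext ?_
      filter_upwards [hg, Lp.coeFn_smul ((c n)⁻¹ : ℂ) (T (lp.single (ENNReal.ofReal q) n 1)),
        hT n] with t h1 h2 h3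
      have := hc n
      rw [h1, h2, Pi.smul_apply, h3, monomial, smul_eq_mul, Complex.ofReal_mul,
        inv_mul_cancel_left₀ (by exact_mod_cast this)]
    change T (B g) - g = 0
    rw [hgT, hB, sub_self]
  exact sub_eq_zero.1 hmem

end Muntz

/-! ### The Carleson embedding -/

open Muntz in
theorem mainTheorem7 (Λ : ℕ → ℝ) (hΛ : Muntz.IsLacunary Λ)
    (μ : Measure ℝ) [IsFiniteMeasure μ] (hμ : μ (Set.Ico (0 : ℝ) 1)ᶜ = 0)
    (p : ℝ) (hp : 1 ≤ p) (hb : Muntz.ConditionSmallB Λ p μ)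
    (q : ℝ) (hpq : p < q) [Fact (1 ≤ ENNReal.ofReal q)] :
    ∃ i : Muntz.muntzSpace Λ q →L[ℂ] Muntz.LpC q μ,
      Muntz.IsCarlesonEmbedding Λ q μ i ∧ IsCompactOperator i := by
  obtain ⟨hpos, r₀, hr₀, hstep⟩ := hΛ
  have hl : LacunaryWith r₀ Λ := ⟨hpos, hstep⟩
  have hq : 1 < q := by linarith
  have hq0 : 0 < q := by linarith
  have hc : 0 < 1 / q := by positivity
  obtain ⟨r, hr, hw⟩ := hl.exists_add_const hr₀ hc
  have hτm : ∀ n, Measurable fun t : ℝ => t ^ Λ n := fun n => by fun_prop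
  have hτ : ∀ t ∈ Ico (0 : ℝ) 1, ∀ n, t ^ Λ n ∈ Icc (0 : ℝ) 1 := fun t ht n =>
    ⟨Real.rpow_nonneg ht.1 _, Real.rpow_le_one ht.1 ht.2.le (hpos n).le⟩
  have hs : ∀ t ∈ Ico (0 : ℝ) 1, Summable fun n => (Λ n + 1 / q) ^ (1 / q) * t ^ Λ n :=
    fun t ht => hl.summable_mul_rpow hr₀ hc hq ht
  have hμae : ∀ᵐ t ∂μ, t ∈ Ico (0 : ℝ) 1 := hμ
  have hmae : ∀ᵐ t ∂lebesgueI, t ∈ Ico (0 : ℝ) 1 :=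
    ae_lebesgueI_mem_Ioo.mono fun t ht => ⟨ht.1.le, ht.2⟩
  -- synthesis into `L^q([0,1])`
  obtain ⟨C₀, hC₀⟩ := exists_lacunarySeriesBound hr le_rfl hq
  obtain ⟨T₀, hT₀⟩ := exists_synthesis (D := 1) hq0 hC₀ hw hτm (hmae.mono hτ) (hmae.mono hs)
    fun n => lintegral_ofReal_mul_rpow_lebesgueI_le (hpos n)
      (by have : 1 / q ≤ 1 := by { rw [div_le_one hq0]; exact hq.le }
          linarith)
  have hT₀s : ∀ k, T₀ (lp.single (ENNReal.ofReal q) k 1) =ᵐ[lebesgueI]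
      fun t => (((Λ k + 1 / q) ^ (1 / q) * t ^ Λ k : ℝ) : ℂ) := fun k => by
    filter_upwards [hT₀ (lp.single (ENNReal.ofReal q) k 1)] with t ht
    rw [ht, tsum_single_mul]
  obtain ⟨B, hB⟩ := exists_leftInverse_synthesis hq hr hw hT₀s
  -- synthesis into `L^q(μ)`
  obtain ⟨C, hC⟩ := exists_lacunarySeriesBound hr hp hpq
  have hlim := tendsto_lintegral_of_conditionSmallB hr₀ hl hμ (by linarith) hb hc
  have hfin : ∀ n, ∫⁻ t, ENNReal.ofReal ((Λ n + 1 / q) * (t ^ Λ n) ^ p) ∂μ ≠ ∞ := fun n => by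
    refine ne_top_of_le_ne_top (b := ENNReal.ofReal (Λ n + 1 / q) * μ univ) (by finiteness) ?_
    rw [← lintegral_const]
    refine lintegral_mono_ae ?_
    filter_upwards [hμae] with t ht
    refine ENNReal.ofReal_le_ofReal (mul_le_of_le_one_right (hw.1 n).le ?_)
    exact Real.rpow_le_one (hτ t ht n).1 (hτ t ht n).2 (by linarith)
  obtain ⟨D, hD⟩ : ∃ D : ℝ≥0, ∀ n,
      ∫⁻ t, ENNReal.ofReal ((Λ n + 1 / q) * (t ^ Λ n) ^ p) ∂μ ≤ D := by
    obtain ⟨D, hD⟩ := ((ENNReal.tendsto_toNNReal ENNReal.zero_ne_top).comp hlim).bddAbove_range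
    exact ⟨D, fun n => by
      rw [← ENNReal.coe_toNNReal (hfin n)]
      exact ENNReal.coe_le_coe.2 (hD ⟨n, rfl⟩)⟩
  obtain ⟨T, hT⟩ := exists_synthesis hq0 hC hw hτm (hμae.mono hτ) (hμae.mono hs) hD
  have hTc : IsCompactOperator T :=
    isCompactOperator_synthesis hq0 hC hw hτm (hμae.mono hτ) (hμae.mono hs) hlim hT
  -- The coefficients `B f` give one Müntz series: it represents `f` almost everywhere for `m`
  -- because synthesis after `B` fixes `f`, and it represents the image of `f` almost everywhere for
  -- `μ` by construction.
  refine ⟨T.comp (B.comp (muntzSpace Λ q).subtypeL), fun f => ?_, hTc.comp_clm _⟩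
  refine ⟨fun t => ∑' n, B f n * (((Λ n + 1 / q) ^ (1 / q) * t ^ Λ n : ℝ) : ℂ),
    ⟨fun n => B f n * (((Λ n + 1 / q) ^ (1 / q) : ℝ) : ℂ), fun t ht => ?_⟩, ?_, hT (B f)⟩
  · have h1 := (summable_coeff_mul (hs t ht) (fun n => mul_nonneg
      (Real.rpow_nonneg (hw.1 n).le _) (hτ t ht n).1) (B f)).hasSum
    refine h1.congr_fun fun n => ?_
    rw [monomial, Complex.ofReal_mul, mul_assoc]
  · have h2 := hT₀ (B f)
    rwa [synthesis_leftInverse_eq_of_mem_muntzSpace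
      (fun n => (Real.rpow_pos_of_pos (hw.1 n) _).ne') hT₀s hB f.2] at h2
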